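/- Let $\alpha\in(-\infty,1)$ and $d\in\mathbb{N}$, $d\ge 1$, and put $\bar\alpha:=2d-\alpha$ and $t_j:=2d(j-1)+1$ for $j\ge 1$. Let $G=((L_1,L_2),(L_3,L_4),\dots)$ be an $(\alpha,t)$-graph, that is, $L_1,L_2,\dots$ are random vertex labels in $\{1,2,\dots\}$ such that $L_n=k$ if $n=t_k$ for some $k\ge1$, and otherwise, conditionally on $L_1,\dots,L_{n-1}$, $$\mathbb{P}[L_n=k\mid L_1,\dots,L_{n-1}]=\frac{|\{i\le n-1: L_i=k\}|-\alpha}{n-1-\alpha\max\{L_1,\dots,L_{n-1}\}}\qquad\text{for } 1\le k\le\max\{L_1,\dots,L_{n-1}\}.$$ Let $\deg_j(n):=|\{i\le n: L_i=j\}|$ be the degree of vertex $j$ after $n$ edge ends. Then there are random variables $\xi_1,\xi_2,\dots$ such that for every integer $r\ge1$, $$\Bigl(\frac{n}{2d}\Bigr)^{-\frac{2d-1}{2d-\alpha}}\bigl(\deg_j(n)\bigr)_{1\le j\le r}\xrightarrow[n\to\infty]{\text{a.s.}}(\xi_j)_{1\le j\le r},$$ and $(\xi_j)_{1\le j\le r}$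 satisfies the following distributional identities. Let $\mathcal{G}_a$ denote a $\mathrm{Gamma}(a,1)$ variable and $\mathcal{B}_{a,b}$ a $\mathrm{Beta}(a,b)$ variable, and let $$Z_r=\prod_{i=1}^{2d-1}\mathcal{G}_{r+1-i/\bar\alpha}^{1/\bar\alpha},\qquad Z'_r=\prod_{i=1}^{2d-1}\mathcal{G}_{1-i/\bar\alpha}^{1/\bar\alpha},\qquad Z''_r=Z'_r\prod_{k=1}^{r-1}\mathcal{B}_{k\bar\alpha,1-\alpha},$$ where all the gamma and beta variables are independent of each other and of $(\xi_j)_j$. Let $\Psi_1=1$ and $\Psi_j\sim\mathrm{Beta}\bigl(1-\alpha,(j-1)(2d-\alpha)\bigr)$ for $j>1$ be independent, and set $V_r:=\bigl(\Psi_j\prod_{i=j+1}^r(1-\Psi_i)\bigr)_{1\le j\le r}$. Then, with all the variables on each right-hand side independent, \begin{align*} Z_r\cdot(\xi_j)_{1\le j\le r}&\overset{d}{=}\mathcal{G}_{r\bar\alpha}\cdot V_r,\\ Z'_r\cdot(\xi_j)_{1\le j\le r}&\overset{d}{=}\mathcal{G}_{r\bar\alpha}\prod_{k=1}^{r}\mathcal{B}_{k\bar\alpha-2d+1,\,2d-1}\cdot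 V_r,\\ Z'_r\cdot(\xi_j)_{1\le j\le r}&\overset{d}{=}\mathcal{G}_{r\bar\alpha-2d+1}\prod_{k=1}^{r-1}\mathcal{B}_{k\bar\alpha-2d+1,\,2d-1}\cdot V_r,\\ Z''_r\cdot(\xi_j)_{1\le j\le r}&\overset{d}{=}\mathcal{G}_{1-\alpha}\cdot V_r. \end{align*} -/

import Mathlib

open MeasureTheory ProbabilityTheory Filter Topology

noncomputable section

namespace PrefAttach

/-- Label sequences `l₁, l₂, …` are functions `l : ℕ → ℕ` read at the indices `1, 2, …`
(the value `l 0` plays no role). `deg l k n` is the number of `i ∈ {1, …, n}` with `lᵢ = k`,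
i.e. the degree of vertex `k` once the first `n` edge ends are present (a loop counts twice). -/
def deg (l : ℕ → ℕ) (k n : ℕ) : ℕ :=
  ((Finset.Icc 1 n).filter fun i => l i = k).card

/-- `max {l₁, …, lₙ}`, the number of vertices among the first `n` edge ends. -/
def maxLabel (l : ℕ → ℕ) (n : ℕ) : ℕ :=
  (Finset.Icc 1 n).sup l

/-- The `α`-degree biased probability of the vertex `k` given the labels `l₁, …, lₙ`;
it is supported on `k ∈ {1, …, max {l₁, …, lₙ}}`. -/
def degreeBiased (α : ℝ) (l : ℕ → ℕ) (n k : ℕ) : ℝ :=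
  if 1 ≤ k ∧ k ≤ maxLabel l n then
    ((deg l k n : ℝ) - α) / ((n : ℝ) - α * (maxLabel l n : ℝ))
  else 0

/-- Sequences of arrival times `1 = t₁ < t₂ < ⋯ ≤ ∞` (strictly increasing as long as they are
finite, `∞` from then on); the value `t 0` plays no role. -/
structure IsArrivalSeq (t : ℕ → ℕ∞) : Prop where
  first : t 1 = 1
  step : ∀ k, 1 ≤ k → t k < t (k + 1) ∨ (t k = ⊤ ∧ t (k + 1) = ⊤)

open Classical in
/-- Conditional probability that the label number `n + 1` is `k`, given the labels `l₁, …, lₙ`: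
if `n + 1` is the arrival time of a vertex, the label is that vertex;
otherwise it is drawn from the `α`-degree biased law. -/
def stepProb (α : ℝ) (t : ℕ → ℕ∞) (l : ℕ → ℕ) (n k : ℕ) : ℝ :=
  if ∃ j, 1 ≤ j ∧ t j = ((n + 1 : ℕ) : ℕ∞) then
    if 1 ≤ k ∧ t k = ((n + 1 : ℕ) : ℕ∞) then 1 else 0
  else degreeBiased α l n k

/-- `L₁, L₂, …` are the edge ends of an `(α, t)`-graph `((L₁, L₂), (L₃, L₄), …)`: conditionally on
`L₁, …, Lₙ`, the label `L_{n+1}` has the law `stepProb`. -/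
structure IsAlphaTGraph {Ω : Type*} [MeasurableSpace Ω] (μ : Measure Ω)
    (α : ℝ) (t : ℕ → ℕ∞) (L : ℕ → Ω → ℕ) : Prop where
  arrival : IsArrivalSeq t
  measurable : ∀ n, Measurable (L n)
  law : ∀ (n : ℕ) (l : ℕ → ℕ),
    μ.real {ω | ∀ i ∈ Finset.Icc 1 (n + 1), L i ω = l i}
      = μ.real {ω | ∀ i ∈ Finset.Icc 1 n, L i ω = l i} * stepProb α t l n (l (n + 1))

/-- Law of the product `X₁ ⋯ X_m` of independent real random variables `X_i ∼ ν i`. -/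
def prodLaw {m : ℕ} (ν : Fin m → Measure ℝ) : Measure ℝ :=
  (Measure.pi ν).map fun x => ∏ i, x i

/-- Law of the random vector `X • V`, for independent `X ∼ ν` (real) and `V ∼ ρ` (vector). -/
def scaledLaw {r : ℕ} (ν : Measure ℝ) (ρ : Measure (Fin r → ℝ)) : Measure (Fin r → ℝ) :=
  (ν.prod ρ).map fun p => p.1 • p.2

/-- Law of `∏_{i=1}^{2d-1} G_{c - i/(2d-α)}^{1/(2d-α)}`, with independent gamma variables
`G_a ∼ Gamma(a, 1)`. -/
def gammaPowLaw (α : ℝ) (d : ℕ) (c : ℝ) : Measure ℝ :=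
  prodLaw fun i : Fin (2 * d - 1) =>
    (gammaMeasure (c - ((i : ℕ) + 1 : ℝ) / (2 * d - α)) 1).map
      fun x => x ^ (1 / (2 * d - α) : ℝ)

/-- Law of `∏_{k=1}^{m} B_{k(2d-α) - 2d + 1, 2d - 1}`, with independent beta variables. -/
def betaProdLaw (α : ℝ) (d m : ℕ) : Measure ℝ :=
  prodLaw fun k : Fin m =>
    betaMeasure (((k : ℕ) + 1 : ℝ) * (2 * d - α) - 2 * d + 1) (2 * d - 1)

/-- Law of `Z_r = ∏_{i=1}^{2d-1} G_{r + 1 - i/(2d-α)}^{1/(2d-α)}`. -/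
def lawZ (α : ℝ) (d r : ℕ) : Measure ℝ :=
  gammaPowLaw α d (r + 1)

/-- Law of `Z'_r = ∏_{i=1}^{2d-1} G_{1 - i/(2d-α)}^{1/(2d-α)}` (it does not depend on `r`). -/
def lawZ' (α : ℝ) (d : ℕ) : Measure ℝ :=
  gammaPowLaw α d 1

/-- Law of `Z''_r = Z'_r ∏_{k=1}^{r-1} B_{k(2d-α), 1-α}`, all factors independent. -/
def lawZ'' (α : ℝ) (d r : ℕ) : Measure ℝ :=
  Measure.mconv (lawZ' α d)
    (prodLaw fun k : Fin (r - 1) => betaMeasure (((k : ℕ) + 1 : ℝ) * (2 * d - α)) (1 - α))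

/-- The stick-breaking vector `(ψ_j ∏_{i=j+1}^r (1 - ψ_i))_{1 ≤ j ≤ r}`
(coordinate `j : Fin r` has the number `j + 1`). -/
def stick {r : ℕ} (ψ : Fin r → ℝ) (j : Fin r) : ℝ :=
  ψ j * ∏ i ∈ Finset.Ioi j, (1 - ψ i)

/-- Law of the stick-breaking vector for independent `Ψ₁ = 1` and
`Ψ_j ∼ Beta(1 - α, (j - 1)(2d - α))`, `2 ≤ j ≤ r`. -/
def stickLaw (α : ℝ) (d r : ℕ) : Measure (Fin r → ℝ) :=
  (Measure.pi fun j : Fin r =>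
    if (j : ℕ) = 0 then Measure.dirac (1 : ℝ)
    else betaMeasure (1 - α) ((j : ℕ) * (2 * d - α))).map stick

end PrefAttach

end

/-! Write A = 2d - α. The quantity that makes the model solvable is `mixedRise`, the product over
vertices of the rising factorials (deg_j - α)(deg_j - α + 1)⋯(deg_j - α + p_j - 1), a vertex not yet
born contributing 1. A biased step that hits vertex j multiplies it by (deg_j - α + p_j)/(deg_j -
α). The numerator of this vertex's probability cancels, and since the degrees sum to n, the mean
growth is a deterministic ratio (`tsum_mixedRise_mul_stepProb`). An arrival contributes a rising
factorial of 1 - α. Hence `mixedRise / meanRise` is a positive martingale of mean one, and it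
converges almost surely.

A single exponent 1 gives convergence of each rescaled degree along the times 2dK, and monotonicity
of the degree fills in the other n. Doubling the exponents bounds second moments, so means pass to
the limit and all mixed moments of ξ are known (`IsAlphaTGraph.integral_prod_pow`). While vertex k +
1 is the newest, total order q contributes `growth α d k q`. A product of these over k is a product
of 2d - 1 ratios of Gamma functions, whose asymptotics are governed by Euler's limit. This produces
the power n^((2d-1)/A) and the moments of Z'.

The four identities are then algebra: `growth` is the reciprocal of a beta moment and also the ratio
of consecutive moments of Z_r, and the stick-breaking moments telescope against it
(`limitMoment_eq`). Equality of moments gives equality of laws because the moments on the right are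
at most C^n n! in total degree n, so exponential moments exist near 0 (`measure_ext_of_moments`).
The variable ξ itself never needs separate moment bounds. -/

namespace PrefAttach

/-! ### The method of moments -/

/-- Real random variables whose exponential moments exist near `0` and whose moments agree have
the same complex moment generating function on the imaginary axis. -/
lemma complexMGF_eq_of_moments {Ω Ω' : Type*} [MeasurableSpace Ω] [MeasurableSpace Ω']
    {μ : Measure Ω} {ν : Measure Ω'} {X : Ω → ℝ} {Y : Ω' → ℝ} {s : ℝ} (hs : 0 < s)
    (hX : ∀ u ∈ Set.Ioo (-s) s, u ∈ integrableExpSet X μ)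
    (hY : ∀ u ∈ Set.Ioo (-s) s, u ∈ integrableExpSet Y ν)
    (h : ∀ n : ℕ, ∫ ω, X ω ^ n ∂μ = ∫ ω, Y ω ^ n ∂ν) (z : ℂ) (hz : z.re = 0) :
    complexMGF X μ z = complexMGF Y ν z := by
  have hX' : Set.Ioo (-s) s ⊆ interior (integrableExpSet X μ) :=
    interior_maximal hX isOpen_Ioo
  have hY' : Set.Ioo (-s) s ⊆ interior (integrableExpSet Y ν) :=
    interior_maximal hY isOpen_Ioo
  have h0 : (0 : ℝ) ∈ Set.Ioo (-s) s := ⟨by linarith, hs⟩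
  -- The Taylor coefficients of the mgf at 0 are the moments over n!, so equal moments give equal
  -- mgfs near 0; the identity theorem on the vertical strip carries this to the imaginary axis.
  have e1 := hasFPowerSeriesAt_mgf (hX' h0)
  have e2 := hasFPowerSeriesAt_mgf (hY' h0)
  simp only [zero_mul, Real.exp_zero, mul_one, h] at e1 e2
  have hev : ∀ᶠ x in 𝓝 (0 : ℝ), mgf X μ x = mgf Y ν x := by
    filter_upwards [e1.eventually_hasSum_sub, e2.eventually_hasSum_sub] with x h1 h2
    exact h1.unique h2
  have hconv : IsPreconnected {z : ℂ | z.re ∈ Set.Ioo (-s) s} :=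
    ((convex_Ioo (-s) s).linear_preimage Complex.reLm).isPreconnected
  have hEq : Set.EqOn (complexMGF X μ) (complexMGF Y ν) {z : ℂ | z.re ∈ Set.Ioo (-s) s} := by
    refine AnalyticOnNhd.eqOn_of_preconnected_of_frequently_eq
      (analyticOnNhd_complexMGF.mono fun z hz => hX' hz)
      (analyticOnNhd_complexMGF.mono fun z hz => hY' hz) hconv (z₀ := ((0 : ℝ) : ℂ))
      (by simpa using h0) ?_
    have h_real : ∃ᶠ (x : ℝ) in 𝓝[≠] 0, complexMGF X μ x = complexMGF Y ν x := by
      refine Eventually.frequently ?_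
      filter_upwards [nhdsWithin_le_nhds hev] with y hy
      rw [complexMGF_ofReal, complexMGF_ofReal, hy]
    have ht : Tendsto (fun x : ℝ => (x : ℂ)) (𝓝[≠] 0) (𝓝[≠] ((0 : ℝ) : ℂ)) := by
      refine tendsto_nhdsWithin_iff.2 ⟨?_, ?_⟩
      · exact (Complex.continuous_ofReal.tendsto 0).mono_left nhdsWithin_le_nhds
      · filter_upwards [self_mem_nhdsWithin] with x hx
        simpa using hx
    exact ht.frequently h_real
  exact hEq (by rw [Set.mem_ofPred_eq, hz]; exact h0)

section Determinacy

variable {r : ℕ} {μ : Measure (Fin r → ℝ)}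

/-- Multinomial theorem: the bound depends only on the total degree, and the multinomial
coefficients sum to r^n. -/
lemma integral_sum_pow_le {C : ℝ}
    (hint : ∀ p : Fin r → ℕ, Integrable (fun x => ∏ j, x j ^ p j) μ)
    (hb : ∀ p : Fin r → ℕ, ∫ x, ∏ j, x j ^ p j ∂μ ≤ C ^ (∑ j, p j) * (∑ j, p j).factorial)
    (n : ℕ) :
    Integrable (fun x => (∑ j, x j) ^ n) μ ∧
      ∫ x, (∑ j, x j) ^ n ∂μ ≤ (r * C) ^ n * n.factorial := by
  simp_rw [Finset.sum_pow_eq_sum_piAntidiag]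
  have hi : ∀ k ∈ Finset.piAntidiag (Finset.univ : Finset (Fin r)) n,
      Integrable (fun x : Fin r → ℝ => (Nat.multinomial Finset.univ k : ℝ) * ∏ i, x i ^ k i) μ :=
    fun k _ => (hint k).const_mul _
  refine ⟨integrable_finsetSum _ hi, ?_⟩
  rw [integral_finsetSum _ hi]
  have h1 : ((r : ℝ)) ^ n = ∑ k ∈ Finset.piAntidiag (Finset.univ : Finset (Fin r)) n,
      (Nat.multinomial Finset.univ k : ℝ) := by
    have := Finset.sum_pow_eq_sum_piAntidiag (R := ℝ) (Finset.univ : Finset (Fin r))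
      (fun _ => 1) n
    simpa using this
  rw [mul_pow, h1, Finset.sum_mul, Finset.sum_mul]
  refine Finset.sum_le_sum fun k hk => ?_
  rw [integral_const_mul, mul_assoc]
  refine mul_le_mul_of_nonneg_left ?_ (Nat.cast_nonneg _)
  have := hb k
  rwa [(Finset.mem_piAntidiag.1 hk).1] at this

/-- Nonnegativity allows the exponential series to be integrated term by term; the factorials cancel
and a geometric series of ratio s r C remains. -/
lemma integrable_exp_sum [IsFiniteMeasure μ] {C : ℝ} (hC : 0 < C)
    (hpos : ∀ᵐ x ∂μ, ∀ j, 0 ≤ x j)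
    (hint : ∀ p : Fin r → ℕ, Integrable (fun x => ∏ j, x j ^ p j) μ)
    (hb : ∀ p : Fin r → ℕ, ∫ x, ∏ j, x j ^ p j ∂μ ≤ C ^ (∑ j, p j) * (∑ j, p j).factorial)
    {s : ℝ} (hs0 : 0 ≤ s) (hs : s * (r * C) < 1) :
    Integrable (fun x : Fin r → ℝ => Real.exp (s * ∑ j, x j)) μ := by
  refine ⟨by fun_prop, ?_⟩
  have h1 : ∀ᵐ x ∂μ, ENNReal.ofReal (Real.exp (s * ∑ j, x j))
      = ∑' n : ℕ, ENNReal.ofReal ((s * ∑ j, x j) ^ n / n.factorial) := by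
    filter_upwards [hpos] with x hx
    have hnn : 0 ≤ s * ∑ j, x j := mul_nonneg hs0 (Finset.sum_nonneg fun j _ => hx j)
    rw [Real.exp_eq_exp_ℝ, NormedSpace.exp_eq_tsum_div]
    exact ENNReal.ofReal_tsum_of_nonneg (fun n => by positivity)
      (Real.summable_pow_div_factorial _)
  rw [hasFiniteIntegral_iff_ofReal (ae_of_all _ fun _ => (Real.exp_pos _).le), lintegral_congr_ae h1,
    lintegral_tsum (fun n => by fun_prop)]
  have h2 : ∀ n : ℕ, ∫⁻ x, ENNReal.ofReal ((s * ∑ j, x j) ^ n / n.factorial) ∂μ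
      ≤ ENNReal.ofReal ((s * (r * C)) ^ n) := by
    intro n
    obtain ⟨hi, hle⟩ := integral_sum_pow_le hint hb n
    rw [← ofReal_integral_eq_lintegral_ofReal]
    · refine ENNReal.ofReal_le_ofReal ?_
      have : ∀ x : Fin r → ℝ, (s * ∑ j, x j) ^ n / (n.factorial : ℝ)
          = (s ^ n / n.factorial) * (∑ j, x j) ^ n := fun x => by ring
      simp_rw [this]
      rw [integral_const_mul]
      calc s ^ n / (n.factorial : ℝ) * ∫ x, (∑ j, x j) ^ n ∂μ
          ≤ s ^ n / (n.factorial : ℝ) * ((r * C) ^ n * n.factorial) := by gcongr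
        _ = (s * (r * C)) ^ n := by
          rw [mul_pow s]
          field_simp
    · have : ∀ x : Fin r → ℝ, (s * ∑ j, x j) ^ n / (n.factorial : ℝ)
          = (s ^ n / n.factorial) * (∑ j, x j) ^ n := fun x => by ring
      simp_rw [this]
      exact hi.const_mul _
    · filter_upwards [hpos] with x hx
      have hnn : 0 ≤ s * ∑ j, x j := mul_nonneg hs0 (Finset.sum_nonneg fun j _ => hx j)
      simp only [Pi.zero_apply]
      positivity
  refine (ENNReal.tsum_le_tsum h2).trans_lt ?_
  have h3 : 0 ≤ s * (r * C) := by positivity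
  rw [← ENNReal.ofReal_tsum_of_nonneg (fun n => by positivity)
    (summable_geometric_of_lt_one h3 hs)]
  exact ENNReal.ofReal_lt_top

/-- The method of moments for random vectors with nonnegative coordinates. -/
theorem measure_ext_of_moments {μ ν : Measure (Fin r → ℝ)} [IsFiniteMeasure μ] [IsFiniteMeasure ν]
    {C : ℝ} (hC : 0 < C)
    (hμ : ∀ᵐ x ∂μ, ∀ j, 0 ≤ x j) (hν : ∀ᵐ x ∂ν, ∀ j, 0 ≤ x j)
    (hμi : ∀ p : Fin r → ℕ, Integrable (fun x => ∏ j, x j ^ p j) μ)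
    (hνi : ∀ p : Fin r → ℕ, Integrable (fun x => ∏ j, x j ^ p j) ν)
    (heq : ∀ p : Fin r → ℕ, ∫ x, ∏ j, x j ^ p j ∂μ = ∫ x, ∏ j, x j ^ p j ∂ν)
    (hb : ∀ p : Fin r → ℕ, ∫ x, ∏ j, x j ^ p j ∂μ ≤ C ^ (∑ j, p j) * (∑ j, p j).factorial) :
    μ = ν := by
  refine Measure.ext_of_charFunDual (funext fun T => ?_)
  rw [charFunDual_apply, charFunDual_apply]
  set B : ℝ := 1 + ∑ j, |T (Pi.single j 1)| with hB
  have hB0 : 0 < B := by positivity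
  have hT : ∀ x, T x = ∑ j, x j * T (Pi.single j 1) := fun x => by
    conv_lhs => rw [← Finset.univ_sum_single x, map_sum]
    refine Finset.sum_congr rfl fun j _ => ?_
    rw [show Pi.single j (x j) = x j • (Pi.single j 1 : Fin r → ℝ) by
      rw [← Pi.single_smul]; simp, map_smul, smul_eq_mul]
  have hTle : ∀ x : Fin r → ℝ, (∀ j, 0 ≤ x j) → |T x| ≤ B * ∑ j, x j := fun x hx => by
    rw [hT, Finset.mul_sum]
    refine (Finset.abs_sum_le_sum_abs _ _).trans (Finset.sum_le_sum fun j _ => ?_)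
    rw [abs_mul, abs_of_nonneg (hx j), mul_comm]
    refine mul_le_mul_of_nonneg_right ?_ (hx j)
    have := Finset.single_le_sum (f := fun j => |T (Pi.single j 1)|)
      (fun i _ => abs_nonneg _) (Finset.mem_univ j)
    linarith
  -- Chosen so that s B · r C = r C/(r C + 1) < 1, as `integrable_exp_sum` requires for the
  -- dominating exponent s B ∑ x_j.
  set s : ℝ := 1 / (B * (r * C + 1)) with hs
  have hrc : 0 < (r : ℝ) * C + 1 := by positivity
  have hs0 : 0 < s := by positivity
  have key : ∀ (ρ : Measure (Fin r → ℝ)) [IsFiniteMeasure ρ], (∀ᵐ x ∂ρ, ∀ j, 0 ≤ x j) →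
      (∀ p : Fin r → ℕ, Integrable (fun x => ∏ j, x j ^ p j) ρ) →
      (∀ p : Fin r → ℕ, ∫ x, ∏ j, x j ^ p j ∂ρ ≤ C ^ (∑ j, p j) * (∑ j, p j).factorial) →
      ∀ u ∈ Set.Ioo (-s) s, u ∈ integrableExpSet (fun x => T x) ρ := by
    intro ρ _ h1 h2 h3 u hu
    have hI := integrable_exp_sum (s := s * B) hC h1 h2 h3 (by positivity) (by
      rw [hs, show 1 / (B * (r * C + 1)) * B * (r * C) = (r * C) / (r * C + 1) by field_simp]
      rw [div_lt_one hrc]; linarith)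
    refine hI.mono' (by fun_prop) ?_
    filter_upwards [h1] with x hx
    rw [Real.norm_of_nonneg (Real.exp_pos _).le]
    refine Real.exp_le_exp.2 ((le_abs_self _).trans ?_)
    rw [abs_mul, mul_assoc]
    exact mul_le_mul (abs_lt.2 hu).le (hTle x hx) (abs_nonneg _) hs0.le
  have := complexMGF_eq_of_moments (μ := μ) (ν := ν) (X := fun x => T x) (Y := fun x => T x) hs0
    (key μ hμ hμi hb) (key ν hν hνi fun p => (heq p) ▸ hb p) (fun n => ?_) Complex.I
    Complex.I_re
  · simpa [complexMGF, mul_comm] using this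
  · have hx : ∀ x : Fin r → ℝ, T x ^ n = ∑ k ∈ Finset.piAntidiag (Finset.univ : Finset (Fin r)) n,
      (Nat.multinomial Finset.univ k * ∏ j, T (Pi.single j 1) ^ k j) * ∏ j, x j ^ k j := by
      intro x
      rw [hT, Finset.sum_pow_eq_sum_piAntidiag]
      refine Finset.sum_congr rfl fun k _ => ?_
      simp_rw [mul_pow]
      rw [Finset.prod_mul_distrib]
      ring
    simp_rw [hx]
    rw [integral_finsetSum _ fun k _ => (hμi k).const_mul _,
      integral_finsetSum _ fun k _ => (hνi k).const_mul _]
    simp_rw [integral_const_mul, heq]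

end Determinacy

/-! ### Rising factorials -/

/-- The rising factorial `a (a + 1) ⋯ (a + n - 1)`. -/
def rise (a : ℝ) (n : ℕ) : ℝ := ∏ i ∈ Finset.range n, (a + i)

@[simp] lemma rise_zero (a : ℝ) : rise a 0 = 1 := by simp [rise]

lemma rise_succ (a : ℝ) (n : ℕ) : rise a (n + 1) = rise a n * (a + n) := by
  simp [rise, Finset.prod_range_succ]

lemma rise_one (a : ℝ) : rise a 1 = a := by simp [rise]

lemma rise_pos {a : ℝ} (ha : 0 < a) (n : ℕ) : 0 < rise a n :=
  Finset.prod_pos fun i _ => by positivity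

lemma rise_add (a : ℝ) (m n : ℕ) : rise a (m + n) = rise a m * rise (a + m) n := by
  simp only [rise, Finset.prod_range_add]
  congr 1
  refine Finset.prod_congr rfl fun i _ => ?_
  push_cast; ring

lemma Gamma_add_natCast {a : ℝ} (ha : 0 < a) (n : ℕ) :
    Real.Gamma (a + n) = Real.Gamma a * rise a n := by
  induction n with
  | zero => simp
  | succ n ih =>
    rw [rise_succ, ← mul_assoc, ← ih, mul_comm, ← Real.Gamma_add_one (by positivity)]
    push_cast; ring_nf

/-- Each factor satisfies a + i ≤ C (i + 1). -/
lemma rise_le_pow_mul_factorial {a C : ℝ} (ha : 0 < a) (h1 : 1 ≤ C) (haC : a ≤ C) (n : ℕ) :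
    rise a n ≤ C ^ n * n.factorial := by
  induction n with
  | zero => simp
  | succ n ih =>
    rw [rise_succ, Nat.factorial_succ, pow_succ]
    have hn : (0 : ℝ) ≤ n := n.cast_nonneg
    calc rise a n * (a + n) ≤ (C ^ n * n.factorial) * (C * (n + 1)) := by
          refine mul_le_mul ih ?_ (by positivity) (by positivity)
          nlinarith
      _ = _ := by push_cast; ring

/-! ### Gamma and beta laws -/

lemma ae_gammaMeasure_nonneg (a r : ℝ) : ∀ᵐ x ∂gammaMeasure a r, 0 ≤ x := by
  rw [gammaMeasure, ae_withDensity_iff (by unfold gammaPDF; fun_prop)]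
  refine ae_of_all _ fun x hx => ?_
  by_contra h
  exact hx (gammaPDF_of_neg (not_le.1 h))

lemma integral_gammaMeasure {a r : ℝ} (ha : 0 < a) (hr : 0 < r) (g : ℝ → ℝ) :
    ∫ x, g x ∂gammaMeasure a r = ∫ x, gammaPDFReal a r x * g x := by
  rw [gammaMeasure, integral_withDensity_eq_integral_toReal_smul
    (f := gammaPDF a r) (measurable_gammaPDFReal a r).ennreal_ofReal (ae_of_all _ fun _ => ENNReal.ofReal_lt_top)]
  simp [gammaPDF, ENNReal.toReal_ofReal (gammaPDFReal_nonneg ha hr _)]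

lemma integral_gammaPDFReal {a r : ℝ} (ha : 0 < a) (hr : 0 < r) :
    ∫ x, gammaPDFReal a r x = 1 := by
  have := isProbabilityMeasure_gammaMeasure ha hr
  simpa using (integral_gammaMeasure ha hr fun _ => 1).symm

lemma integral_rpow_gammaMeasure {a s : ℝ} (ha : 0 < a) (hs : 0 ≤ s) :
    ∫ x, x ^ s ∂gammaMeasure a 1 = Real.Gamma (a + s) / Real.Gamma a := by
  rw [integral_gammaMeasure ha one_pos]
  have h : ∀ᵐ x : ℝ, gammaPDFReal a 1 x * x ^ s
      = Real.Gamma (a + s) / Real.Gamma a * gammaPDFReal (a + s) 1 x := by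
    -- Splitting the power x^(a-1+s) needs x > 0; the point 0 is null.
    filter_upwards [compl_mem_ae_iff.2 (measure_singleton (0 : ℝ))] with x hx
    have hx0 : x ≠ 0 := hx
    unfold gammaPDFReal
    split_ifs with h0
    · have hx' : 0 < x := lt_of_le_of_ne h0 hx0.symm
      have g1 := (Real.Gamma_pos_of_pos ha).ne'
      have g2 := (Real.Gamma_pos_of_pos (add_pos_of_pos_of_nonneg ha hs)).ne'
      rw [show a + s - 1 = a - 1 + s by ring, Real.rpow_add hx']
      simp only [Real.one_rpow]
      field_simp
    · simp
  rw [integral_congr_ae h, integral_const_mul, integral_gammaPDFReal (by positivity) one_pos,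
    mul_one]

lemma integral_pow_gammaMeasure {a : ℝ} (ha : 0 < a) (n : ℕ) :
    ∫ x, x ^ n ∂gammaMeasure a 1 = rise a n := by
  simp_rw [← Real.rpow_natCast]
  rw [integral_rpow_gammaMeasure ha n.cast_nonneg, Gamma_add_natCast ha]
  field_simp [(Real.Gamma_pos_of_pos ha).ne']

lemma ae_betaMeasure_mem (a b : ℝ) : ∀ᵐ x ∂betaMeasure a b, 0 ≤ x ∧ x ≤ 1 := by
  rw [betaMeasure, ae_withDensity_iff (by unfold betaPDF; fun_prop)]
  refine ae_of_all _ fun x hx => ⟨?_, ?_⟩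
  · by_contra h
    exact hx (betaPDF_eq_zero_of_nonpos (not_le.1 h).le)
  · by_contra h
    exact hx (betaPDF_eq_zero_of_one_le (not_le.1 h).le)

lemma integral_betaMeasure {a b : ℝ} (ha : 0 < a) (hb : 0 < b) (g : ℝ → ℝ) :
    ∫ x, g x ∂betaMeasure a b = ∫ x, betaPDFReal a b x * g x := by
  have hnn : ∀ x, 0 ≤ betaPDFReal a b x := fun x => by
    by_cases h : 0 < x ∧ x < 1
    · exact (betaPDFReal_pos h.1 h.2 ha hb).le
    · rw [betaPDFReal, if_neg h]
  rw [betaMeasure, integral_withDensity_eq_integral_toReal_smul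
    (f := betaPDF a b) (measurable_betaPDFReal a b).ennreal_ofReal (ae_of_all _ fun _ => ENNReal.ofReal_lt_top)]
  simp [betaPDF, ENNReal.toReal_ofReal (hnn _)]

lemma integral_betaPDFReal {a b : ℝ} (ha : 0 < a) (hb : 0 < b) :
    ∫ x, betaPDFReal a b x = 1 := by
  have := isProbabilityMeasureBeta ha hb
  simpa using (integral_betaMeasure ha hb fun _ => 1).symm

/-- Weighting the density by x^p (1 - x)^q yields a multiple of the Beta(a + p, b + q) density, so
only the ratio of normalizing constants is left. -/
lemma integral_pow_mul_pow_betaMeasure {a b : ℝ} (ha : 0 < a) (hb : 0 < b) (p q : ℕ) :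
    ∫ x, x ^ p * (1 - x) ^ q ∂betaMeasure a b = rise a p * rise b q / rise (a + b) (p + q) := by
  rw [integral_betaMeasure ha hb]
  have e : beta (a + p) (b + q) = beta a b * (rise a p * rise b q / rise (a + b) (p + q)) := by
    rw [beta, beta, Gamma_add_natCast ha, Gamma_add_natCast hb,
      show a + p + (b + q) = a + b + ((p + q : ℕ) : ℝ) by push_cast; ring,
      Gamma_add_natCast (add_pos ha hb)]
    have := (Real.Gamma_pos_of_pos (add_pos ha hb)).ne'
    have := (rise_pos (add_pos ha hb) (p + q)).ne'
    field_simp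
  have h : ∀ x : ℝ, betaPDFReal a b x * (x ^ p * (1 - x) ^ q)
      = rise a p * rise b q / rise (a + b) (p + q) * betaPDFReal (a + p) (b + q) x := by
    intro x
    unfold betaPDFReal
    split_ifs with h0
    · have hx : 0 < x := h0.1
      have hx1 : 0 < 1 - x := by linarith [h0.2]
      have := (beta_pos ha hb).ne'
      have := (rise_pos (add_pos ha hb) (p + q)).ne'
      have := (rise_pos ha p).ne'
      have := (rise_pos hb q).ne'
      rw [e, show a + p - 1 = a - 1 + p by ring, show b + q - 1 = b - 1 + q by ring,
        Real.rpow_add hx, Real.rpow_add hx1, Real.rpow_natCast, Real.rpow_natCast]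
      field_simp
    · simp
  simp_rw [h]
  rw [integral_const_mul, integral_betaPDFReal (by positivity) (by positivity), mul_one]

lemma integral_pow_betaMeasure {a b : ℝ} (ha : 0 < a) (hb : 0 < b) (n : ℕ) :
    ∫ x, x ^ n ∂betaMeasure a b = rise a n / rise (a + b) n := by
  simpa using integral_pow_mul_pow_betaMeasure ha hb n 0

/-! ### Products, scalings and stick breaking -/

lemma integral_pow_prodLaw {m : ℕ} (ν : Fin m → Measure ℝ) [∀ i, IsProbabilityMeasure (ν i)]
    (n : ℕ) : ∫ x, x ^ n ∂prodLaw ν = ∏ i, ∫ x, x ^ n ∂ν i := by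
  rw [prodLaw, integral_map (by fun_prop) (by fun_prop)]
  simp_rw [← Finset.prod_pow]
  exact integral_fintype_prod_eq_prod fun _ x => x ^ n

instance {m : ℕ} (ν : Fin m → Measure ℝ) [∀ i, IsProbabilityMeasure (ν i)] :
    IsProbabilityMeasure (prodLaw ν) :=
  Measure.isProbabilityMeasure_map (by fun_prop)

lemma ae_pi_of_ae {m : ℕ} {ν : Fin m → Measure ℝ} [∀ i, IsProbabilityMeasure (ν i)]
    {s : Fin m → ℝ → Prop} (h : ∀ i, ∀ᵐ x ∂ν i, s i x) :
    ∀ᵐ x ∂Measure.pi ν, ∀ i, s i (x i) :=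
  ae_all_iff.2 fun i => (Measure.tendsto_eval_ae_ae (μ := ν) (i := i)).eventually (h i)

lemma ae_prodLaw_nonneg {m : ℕ} (ν : Fin m → Measure ℝ) [∀ i, IsProbabilityMeasure (ν i)]
    (h : ∀ i, ∀ᵐ x ∂ν i, 0 ≤ x) : ∀ᵐ x ∂prodLaw ν, 0 ≤ x := by
  rw [prodLaw, ae_map_iff (by fun_prop) measurableSet_Ici]
  filter_upwards [ae_pi_of_ae h] with x hx
  exact Finset.prod_nonneg fun i _ => hx i

lemma integral_pow_mconv (μ ν : Measure ℝ) [IsProbabilityMeasure μ] [IsProbabilityMeasure ν]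
    (n : ℕ) : ∫ x, x ^ n ∂Measure.mconv μ ν = (∫ x, x ^ n ∂μ) * ∫ x, x ^ n ∂ν := by
  rw [Measure.mconv, integral_map (by fun_prop) (by fun_prop)]
  simp_rw [mul_pow]
  exact integral_prod_mul (fun x : ℝ => x ^ n) fun x => x ^ n

lemma ae_prod_and {β γ : Type*} [MeasurableSpace β] [MeasurableSpace γ] {μ : Measure β}
    {ν : Measure γ} [SFinite μ] [SFinite ν] {s : β → Prop} {t : γ → Prop}
    (hs : ∀ᵐ x ∂μ, s x) (ht : ∀ᵐ y ∂ν, t y) : ∀ᵐ z ∂μ.prod ν, s z.1 ∧ t z.2 :=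
  (Measure.quasiMeasurePreserving_fst.ae hs).and (Measure.quasiMeasurePreserving_snd.ae ht)

lemma ae_mconv_nonneg (μ ν : Measure ℝ) [IsProbabilityMeasure μ] [IsProbabilityMeasure ν]
    (hμ : ∀ᵐ x ∂μ, 0 ≤ x) (hν : ∀ᵐ x ∂ν, 0 ≤ x) : ∀ᵐ x ∂Measure.mconv μ ν, 0 ≤ x := by
  rw [Measure.mconv, ae_map_iff (by fun_prop) measurableSet_Ici]
  filter_upwards [ae_prod_and hμ hν] with x hx
  exact mul_nonneg hx.1 hx.2

section Scaled

variable {r : ℕ} (ν : Measure ℝ) (ρ : Measure (Fin r → ℝ)) [IsProbabilityMeasure ν]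
  [IsProbabilityMeasure ρ]

instance : IsProbabilityMeasure (scaledLaw ν ρ) :=
  Measure.isProbabilityMeasure_map (by fun_prop)

/-- A monomial is homogeneous, so the radial variable enters only through the total degree. -/
lemma integral_scaledLaw (p : Fin r → ℕ) :
    ∫ x, ∏ j, x j ^ p j ∂scaledLaw ν ρ = (∫ x, x ^ (∑ j, p j) ∂ν) * ∫ x, ∏ j, x j ^ p j ∂ρ := by
  rw [scaledLaw, integral_map (by fun_prop)
    (Continuous.aestronglyMeasurable (by fun_prop))]
  simp_rw [Pi.smul_apply, smul_eq_mul, mul_pow, Finset.prod_mul_distrib,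
    Finset.prod_pow_eq_pow_sum]
  exact integral_prod_mul (fun x : ℝ => x ^ (∑ j, p j)) fun x : Fin r → ℝ => ∏ j, x j ^ p j

variable {ν ρ}

lemma ae_scaledLaw_nonneg (hν : ∀ᵐ x ∂ν, 0 ≤ x) (hρ : ∀ᵐ x ∂ρ, ∀ j, 0 ≤ x j) :
    ∀ᵐ x ∂scaledLaw ν ρ, ∀ j, 0 ≤ x j := by
  have hm : MeasurableSet {x : Fin r → ℝ | ∀ j, 0 ≤ x j} := by
    rw [Set.ofPred_forall]
    exact MeasurableSet.iInter fun j => measurableSet_le measurable_const (measurable_pi_apply j)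
  rw [scaledLaw, ae_map_iff (by fun_prop) hm]
  filter_upwards [ae_prod_and hν hρ] with x hx j
  exact mul_nonneg hx.1 (hx.2 j)

theorem scaledLaw_eq_of_moments {ν' : Measure ℝ} {ρ' : Measure (Fin r → ℝ)}
    [IsProbabilityMeasure ν'] [IsProbabilityMeasure ρ']
    (hν : ∀ᵐ x ∂ν, 0 ≤ x) (hρ : ∀ᵐ x ∂ρ, ∀ j, 0 ≤ x j)
    (hν' : ∀ᵐ x ∂ν', 0 ≤ x) (hρ' : ∀ᵐ x ∂ρ', ∀ j, 0 ≤ x j)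
    (h : ∀ p : Fin r → ℕ, (∫ x, x ^ (∑ j, p j) ∂ν) * ∫ x, ∏ j, x j ^ p j ∂ρ
      = (∫ x, x ^ (∑ j, p j) ∂ν') * ∫ x, ∏ j, x j ^ p j ∂ρ')
    (h0 : ∀ n : ℕ, 0 < ∫ x, x ^ n ∂ν') (h0' : ∀ p : Fin r → ℕ, 0 < ∫ x, ∏ j, x j ^ p j ∂ρ')
    {C : ℝ} (hC : 0 < C) (hb : ∀ n : ℕ, ∫ x, x ^ n ∂ν' ≤ C ^ n * n.factorial)
    (hb' : ∀ p : Fin r → ℕ, ∫ x, ∏ j, x j ^ p j ∂ρ' ≤ 1) :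
    scaledLaw ν ρ = scaledLaw ν' ρ' := by
  have hpos : ∀ p : Fin r → ℕ, 0 < ∫ x, ∏ j, x j ^ p j ∂scaledLaw ν' ρ' := fun p => by
    rw [integral_scaledLaw]
    exact mul_pos (h0 _) (h0' p)
  have heq : ∀ p : Fin r → ℕ, ∫ x, ∏ j, x j ^ p j ∂scaledLaw ν ρ
      = ∫ x, ∏ j, x j ^ p j ∂scaledLaw ν' ρ' := fun p => by
    rw [integral_scaledLaw, integral_scaledLaw, h p]
  refine measure_ext_of_moments hC (ae_scaledLaw_nonneg hν hρ) (ae_scaledLaw_nonneg hν' hρ')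
    -- A non-integrable function has integral 0 by convention, so positivity of the moments on the
    -- right yields integrability on both sides.
    (fun p => .of_integral_ne_zero (heq p ▸ (hpos p).ne'))
    (fun p => .of_integral_ne_zero (hpos p).ne') heq fun p => ?_
  rw [heq, integral_scaledLaw]
  exact (mul_le_of_le_one_right (h0 _).le (hb' p)).trans (hb _)

end Scaled

lemma integral_le_one_of_ae_mem {β : Type*} [MeasurableSpace β] {μ : Measure β}
    [IsProbabilityMeasure μ] {f : β → ℝ} (h : ∀ᵐ x ∂μ, 0 ≤ f x ∧ f x ≤ 1) : ∫ x, f x ∂μ ≤ 1 := by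
  have := integral_mono_of_nonneg (μ := μ) (g := fun _ => (1 : ℝ)) (h.mono fun _ hx => hx.1)
    (integrable_const _) (h.mono fun _ hx => hx.2)
  simpa using this

/-- The factor 1 - ψ_j occurs in every coordinate before j; regrouping by stick variable separates
the independent factors. -/
lemma prod_stick_pow {r : ℕ} (ψ : Fin r → ℝ) (p : Fin r → ℕ) :
    ∏ j, stick ψ j ^ p j = ∏ j, (ψ j ^ p j * (1 - ψ j) ^ (∑ i ∈ Finset.Iio j, p i)) := by
  simp_rw [stick, mul_pow]
  rw [Finset.prod_mul_distrib, Finset.prod_mul_distrib]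
  congr 1
  simp_rw [← Finset.prod_pow, ← Finset.prod_pow_eq_pow_sum]
  exact Finset.prod_comm' (by simp)

lemma stick_mem {r : ℕ} {ψ : Fin r → ℝ} (h : ∀ j, 0 ≤ ψ j ∧ ψ j ≤ 1) (j : Fin r) :
    0 ≤ stick ψ j ∧ stick ψ j ≤ 1 := by
  have h0 : ∀ i, 0 ≤ 1 - ψ i := fun i => by linarith [(h i).2]
  have h1 : ∀ i, 1 - ψ i ≤ 1 := fun i => by linarith [(h i).1]
  refine ⟨mul_nonneg (h j).1 (Finset.prod_nonneg fun i _ => h0 i), ?_⟩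
  exact mul_le_one₀ (h j).2 (Finset.prod_nonneg fun i _ => h0 i)
    (Finset.prod_le_one (fun i _ => h0 i) fun i _ => h1 i)

lemma measurable_stick {r : ℕ} : Measurable (stick (r := r)) :=
  measurable_pi_lambda _ fun j => by unfold stick; fun_prop

/-- The law of `Ψ_{j+1}`. -/
noncomputable def sliceLaw (α : ℝ) (d j : ℕ) : Measure ℝ :=
  if j = 0 then Measure.dirac (1 : ℝ) else betaMeasure (1 - α) (j * (2 * d - α))

section Model

variable {α : ℝ} {d : ℕ}

lemma two_mul_sub_pos (hα : α < 1) (hd : 1 ≤ d) : 0 < 2 * (d : ℝ) - α := by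
  have : (1 : ℝ) ≤ d := by exact_mod_cast hd
  linarith

lemma isProbabilityMeasure_sliceLaw (hα : α < 1) (hd : 1 ≤ d) (j : ℕ) :
    IsProbabilityMeasure (sliceLaw α d j) := by
  unfold sliceLaw
  split_ifs with h
  · infer_instance
  · have : 0 < j := Nat.pos_of_ne_zero h
    have := two_mul_sub_pos hα hd
    exact isProbabilityMeasureBeta (by linarith) (by positivity)

lemma ae_sliceLaw_mem (α : ℝ) (d j : ℕ) : ∀ᵐ x ∂sliceLaw α d j, 0 ≤ x ∧ x ≤ 1 := by
  unfold sliceLaw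
  split_ifs
  · rw [ae_dirac_iff (by measurability)]; norm_num
  · exact ae_betaMeasure_mem _ _

/-- The mixed moment of the stick-breaking vector contributed by `Ψ_{j+1}`. -/
noncomputable def sliceMoment (α : ℝ) (d : ℕ) (p : ℕ → ℕ) (j : ℕ) : ℝ :=
  if j = 0 then 1 else rise (1 - α) (p j) * rise (j * (2 * d - α)) (∑ i ∈ Finset.range j, p i)
    / rise ((j + 1) * (2 * d - α) - 2 * d + 1) (∑ i ∈ Finset.range (j + 1), p i)

lemma integral_sliceLaw (hα : α < 1) (hd : 1 ≤ d) (p : ℕ → ℕ) (j : ℕ) :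
    ∫ x, x ^ p j * (1 - x) ^ (∑ i ∈ Finset.range j, p i) ∂sliceLaw α d j
      = sliceMoment α d p j := by
  unfold sliceLaw sliceMoment
  split_ifs with h
  -- At Ψ₁ = 1 the exponent of 1 - x is an empty sum, and 0^0 = 1.
  · subst h; simp
  · have : 0 < j := Nat.pos_of_ne_zero h
    have := two_mul_sub_pos hα hd
    -- The beta parameters add up to (1 - α) + jA = (j + 1)A - 2d + 1, the base point of `growth α d
    -- j`.
    rw [integral_pow_mul_pow_betaMeasure (by linarith) (by positivity), Finset.sum_range_succ,
      add_comm (p j)]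
    congr 2
    ring

lemma stickLaw_eq (α : ℝ) (d r : ℕ) :
    stickLaw α d r = (Measure.pi fun j : Fin r => sliceLaw α d j).map stick := rfl

lemma isProbabilityMeasure_stickLaw (hα : α < 1) (hd : 1 ≤ d) (r : ℕ) :
    IsProbabilityMeasure (stickLaw α d r) := by
  have := fun j => isProbabilityMeasure_sliceLaw hα hd j
  rw [stickLaw_eq]
  exact Measure.isProbabilityMeasure_map measurable_stick.aemeasurable

lemma ae_stickLaw_mem (hα : α < 1) (hd : 1 ≤ d) (r : ℕ) :
    ∀ᵐ x ∂stickLaw α d r, ∀ j, 0 ≤ x j ∧ x j ≤ 1 := by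
  have := fun j => isProbabilityMeasure_sliceLaw hα hd j
  have hm : MeasurableSet {x : Fin r → ℝ | ∀ j, 0 ≤ x j ∧ x j ≤ 1} := by
    rw [Set.ofPred_forall]
    exact MeasurableSet.iInter fun j => measurable_pi_apply j measurableSet_Icc
  rw [stickLaw_eq, ae_map_iff measurable_stick.aemeasurable hm]
  filter_upwards [ae_pi_of_ae fun j : Fin r => ae_sliceLaw_mem α d j] with ψ hψ
  exact stick_mem hψ

lemma integral_stickLaw (hα : α < 1) (hd : 1 ≤ d) (r : ℕ) (p : ℕ → ℕ) :
    ∫ x, ∏ j : Fin r, x j ^ p j ∂stickLaw α d r = ∏ j ∈ Finset.range r, sliceMoment α d p j := by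
  have := fun j => isProbabilityMeasure_sliceLaw hα hd j
  rw [stickLaw_eq, integral_map measurable_stick.aemeasurable
    (Continuous.aestronglyMeasurable (by fun_prop)), Finset.prod_range]
  simp_rw [prod_stick_pow _ fun j : Fin r => p j, ← integral_sliceLaw hα hd p]
  rw [integral_fintype_prod_eq_prod (𝕜 := ℝ) (μ := fun j : Fin r => sliceLaw α d j)
    fun (j : Fin r) x => x ^ p j * (1 - x) ^ (∑ i ∈ Finset.Iio j, p i)]
  refine Finset.prod_congr rfl fun j _ => ?_
  congr! 4
  refine Finset.sum_nbij (fun i : Fin r => (i : ℕ)) (by simp) (Fin.val_injective.injOn) ?_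
    fun _ _ => rfl
  intro i hi
  have hi : i < j := by simpa using hi
  exact ⟨⟨i, hi.trans j.2⟩, by simpa [Fin.lt_def] using hi, rfl⟩

lemma integral_stickLaw_le_one (hα : α < 1) (hd : 1 ≤ d) {r : ℕ} (p : Fin r → ℕ) :
    ∫ x, ∏ j : Fin r, x j ^ p j ∂stickLaw α d r ≤ 1 := by
  have := isProbabilityMeasure_stickLaw hα hd r
  refine integral_le_one_of_ae_mem ?_
  filter_upwards [ae_stickLaw_mem hα hd r] with x hx
  exact ⟨Finset.prod_nonneg fun j _ => pow_nonneg (hx j).1 _,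
    Finset.prod_le_one (fun j _ => pow_nonneg (hx j).1 _) fun j _ => pow_le_one₀ (hx j).1 (hx j).2⟩

end Model

section Model

variable {α : ℝ} {d : ℕ}

/-! ### Moments of the laws in the statement -/

/-- Makes every gamma parameter c - (i + 1)/A with c ≥ 1 positive: i + 1 ≤ 2d - 1 < A. -/
lemma div_lt_one_of_lt_two_mul (hα : α < 1) (hd : 1 ≤ d) {i : ℕ} (hi : i < 2 * d - 1) :
    ((i : ℝ) + 1) / (2 * d - α) < 1 := by
  rw [div_lt_one (two_mul_sub_pos hα hd)]
  have : i + 2 ≤ 2 * d := by omega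
  have : ((i : ℝ) + 2) ≤ 2 * d := by exact_mod_cast this
  linarith

/-- The law of one factor `G_{c - (i + 1)/(2d-α)}^{1/(2d-α)}`. -/
noncomputable def gammaRootLaw (α : ℝ) (d : ℕ) (c : ℝ) (i : ℕ) : Measure ℝ :=
  (gammaMeasure (c - ((i : ℝ) + 1) / (2 * d - α)) 1).map fun x => x ^ (1 / (2 * d - α) : ℝ)

lemma gammaPowLaw_eq (α : ℝ) (d : ℕ) (c : ℝ) :
    gammaPowLaw α d c = prodLaw fun i : Fin (2 * d - 1) => gammaRootLaw α d c i := rfl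

lemma isProbabilityMeasure_gammaRootLaw (hα : α < 1) (hd : 1 ≤ d) {c : ℝ} (hc : 1 ≤ c)
    (i : Fin (2 * d - 1)) : IsProbabilityMeasure (gammaRootLaw α d c i) := by
  have := div_lt_one_of_lt_two_mul hα hd i.2
  have := isProbabilityMeasure_gammaMeasure (a := c - ((i : ℝ) + 1) / (2 * d - α)) (r := 1)
    (by linarith) one_pos
  exact Measure.isProbabilityMeasure_map (by fun_prop)

lemma ae_gammaRootLaw_nonneg (α : ℝ) (d : ℕ) (c : ℝ) (i : ℕ) :
    ∀ᵐ x ∂gammaRootLaw α d c i, 0 ≤ x := by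
  rw [gammaRootLaw, ae_map_iff (by fun_prop) measurableSet_Ici]
  filter_upwards [ae_gammaMeasure_nonneg _ _] with x hx
  exact Real.rpow_nonneg hx _

lemma isProbabilityMeasure_gammaPowLaw (hα : α < 1) (hd : 1 ≤ d) {c : ℝ} (hc : 1 ≤ c) :
    IsProbabilityMeasure (gammaPowLaw α d c) := by
  have := fun i => isProbabilityMeasure_gammaRootLaw hα hd hc i
  rw [gammaPowLaw_eq]; infer_instance

lemma ae_gammaPowLaw_nonneg (hα : α < 1) (hd : 1 ≤ d) {c : ℝ} (hc : 1 ≤ c) :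
    ∀ᵐ x ∂gammaPowLaw α d c, 0 ≤ x := by
  have := fun i => isProbabilityMeasure_gammaRootLaw hα hd hc i
  rw [gammaPowLaw_eq]
  exact ae_prodLaw_nonneg _ fun i => ae_gammaRootLaw_nonneg _ _ _ _

lemma integral_pow_gammaPowLaw (hα : α < 1) (hd : 1 ≤ d) {c : ℝ} (hc : 1 ≤ c) (n : ℕ) :
    ∫ x, x ^ n ∂gammaPowLaw α d c = ∏ i ∈ Finset.range (2 * d - 1),
      Real.Gamma (c - ((i : ℝ) + 1) / (2 * d - α) + n / (2 * d - α))
        / Real.Gamma (c - ((i : ℝ) + 1) / (2 * d - α)) := by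
  have := fun i => isProbabilityMeasure_gammaRootLaw hα hd hc i
  have hA := two_mul_sub_pos hα hd
  rw [gammaPowLaw_eq, integral_pow_prodLaw, Finset.prod_range]
  refine Finset.prod_congr rfl fun i _ => ?_
  have hi := div_lt_one_of_lt_two_mul hα hd i.2
  rw [gammaRootLaw, integral_map (by fun_prop) (by fun_prop),
    ← integral_rpow_gammaMeasure (by linarith) (by positivity)]
  refine integral_congr_ae ?_
  filter_upwards [ae_gammaMeasure_nonneg _ _] with x hx
  rw [← Real.rpow_natCast, ← Real.rpow_mul hx]
  congr 1
  ring

lemma two_mul_sub_one_pos (hd : 1 ≤ d) : 0 < 2 * (d : ℝ) - 1 := by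
  have : (1 : ℝ) ≤ d := by exact_mod_cast hd
  linarith

lemma succ_mul_sub_pos (hα : α < 1) (hd : 1 ≤ d) (k : ℕ) :
    0 < ((k : ℝ) + 1) * (2 * d - α) - 2 * d + 1 := by
  have := two_mul_sub_pos hα hd
  have : 0 ≤ (k : ℝ) * (2 * d - α) := by positivity
  linarith

lemma isProbabilityMeasure_betaProdLaw (hα : α < 1) (hd : 1 ≤ d) (m : ℕ) :
    IsProbabilityMeasure (betaProdLaw α d m) := by
  have : ∀ k : Fin m, IsProbabilityMeasure
    (betaMeasure (((k : ℕ) + 1 : ℝ) * (2 * d - α) - 2 * d + 1) (2 * d - 1)) :=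
    fun k => isProbabilityMeasureBeta (succ_mul_sub_pos hα hd k) (two_mul_sub_one_pos hd)
  unfold betaProdLaw; infer_instance

lemma ae_betaProdLaw_nonneg (hα : α < 1) (hd : 1 ≤ d) (m : ℕ) :
    ∀ᵐ x ∂betaProdLaw α d m, 0 ≤ x := by
  have : ∀ k : Fin m, IsProbabilityMeasure
    (betaMeasure (((k : ℕ) + 1 : ℝ) * (2 * d - α) - 2 * d + 1) (2 * d - 1)) :=
    fun k => isProbabilityMeasureBeta (succ_mul_sub_pos hα hd k) (two_mul_sub_one_pos hd)
  exact ae_prodLaw_nonneg _ fun k => (ae_betaMeasure_mem _ _).mono fun _ h => h.1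

/-- The `n`-th moment of a `Beta(k(2d-α) - 2d + 1, 2d - 1)` variable, with `k` shifted by one. -/
noncomputable def betaMoment (α : ℝ) (d n k : ℕ) : ℝ :=
  rise (((k : ℝ) + 1) * (2 * d - α) - 2 * d + 1) n / rise (((k : ℝ) + 1) * (2 * d - α)) n

lemma betaMoment_pos (hα : α < 1) (hd : 1 ≤ d) (n k : ℕ) : 0 < betaMoment α d n k := by
  have := two_mul_sub_pos hα hd
  exact div_pos (rise_pos (succ_mul_sub_pos hα hd k) n) (rise_pos (by positivity) n)

lemma betaMoment_le_one (hα : α < 1) (hd : 1 ≤ d) (n k : ℕ) : betaMoment α d n k ≤ 1 := by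
  have := two_mul_sub_pos hα hd
  have h2 := succ_mul_sub_pos hα hd k
  rw [betaMoment, div_le_one (rise_pos (by positivity) n)]
  refine Finset.prod_le_prod (fun i _ => by positivity) fun i _ => ?_
  linarith [two_mul_sub_one_pos hd]

lemma integral_pow_betaProdLaw (hα : α < 1) (hd : 1 ≤ d) (m n : ℕ) :
    ∫ x, x ^ n ∂betaProdLaw α d m = ∏ k ∈ Finset.range m, betaMoment α d n k := by
  have : ∀ k : Fin m, IsProbabilityMeasure
    (betaMeasure (((k : ℕ) + 1 : ℝ) * (2 * d - α) - 2 * d + 1) (2 * d - 1)) :=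
    fun k => isProbabilityMeasureBeta (succ_mul_sub_pos hα hd k) (two_mul_sub_one_pos hd)
  rw [betaProdLaw, integral_pow_prodLaw, Finset.prod_range]
  refine Finset.prod_congr rfl fun k _ => ?_
  rw [integral_pow_betaMeasure (succ_mul_sub_pos hα hd k) (two_mul_sub_one_pos hd), betaMoment]
  congr 2
  ring

/-- The law of `∏_{k=1}^{r-1} B_{k(2d-α), 1-α}`. -/
noncomputable def ratioProdLaw (α : ℝ) (d r : ℕ) : Measure ℝ :=
  prodLaw fun k : Fin (r - 1) => betaMeasure (((k : ℕ) + 1 : ℝ) * (2 * d - α)) (1 - α)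

lemma isProbabilityMeasure_ratioBeta (hα : α < 1) (hd : 1 ≤ d) (k : ℕ) :
    IsProbabilityMeasure (betaMeasure (((k : ℕ) + 1 : ℝ) * (2 * d - α)) (1 - α)) := by
  have := two_mul_sub_pos hα hd
  exact isProbabilityMeasureBeta (by positivity) (by linarith)

lemma isProbabilityMeasure_ratioProdLaw (hα : α < 1) (hd : 1 ≤ d) (r : ℕ) :
    IsProbabilityMeasure (ratioProdLaw α d r) := by
  have := fun k => isProbabilityMeasure_ratioBeta hα hd k
  unfold ratioProdLaw; infer_instance

lemma ae_ratioProdLaw_nonneg (hα : α < 1) (hd : 1 ≤ d) (r : ℕ) :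
    ∀ᵐ x ∂ratioProdLaw α d r, 0 ≤ x := by
  have := fun k => isProbabilityMeasure_ratioBeta hα hd k
  exact ae_prodLaw_nonneg _ fun k => (ae_betaMeasure_mem _ _).mono fun _ h => h.1

lemma integral_pow_ratioProdLaw (hα : α < 1) (hd : 1 ≤ d) (r n : ℕ) :
    ∫ x, x ^ n ∂ratioProdLaw α d r = ∏ k ∈ Finset.range (r - 1),
      rise (((k : ℝ) + 1) * (2 * d - α)) n / rise (((k : ℝ) + 2) * (2 * d - α) - 2 * d + 1) n := by
  have := fun k => isProbabilityMeasure_ratioBeta hα hd k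
  have hA := two_mul_sub_pos hα hd
  rw [ratioProdLaw, integral_pow_prodLaw, Finset.prod_range]
  refine Finset.prod_congr rfl fun k _ => ?_
  rw [integral_pow_betaMeasure (by positivity) (by linarith)]
  congr 2
  ring

/-! ### The algebra relating these moments -/

/-- The factor by which the expected mixed rising factorial of total order `q` grows
while the vertex `k + 1` is the newest one. -/
noncomputable def growth (α : ℝ) (d k q : ℕ) : ℝ :=
  rise (((k : ℝ) + 1) * (2 * d - α) - 2 * d + 1 + q) (2 * d - 1)
    / rise (((k : ℝ) + 1) * (2 * d - α) - 2 * d + 1) (2 * d - 1)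

lemma growth_pos (hα : α < 1) (hd : 1 ≤ d) (k q : ℕ) : 0 < growth α d k q := by
  have := succ_mul_sub_pos hα hd k
  exact div_pos (rise_pos (by positivity) _) (rise_pos this _)

/-- The rising factorial of length q + (2d - 1) from the base point is split after q and after 2d -
1 factors. This turns a ratio of fixed length 2d - 1 into one of length q, comparable with gamma and
beta moments. -/
lemma growth_eq (hα : α < 1) (hd : 1 ≤ d) (k q : ℕ) :
    growth α d k q = rise (((k : ℝ) + 1) * (2 * d - α)) q
      / rise (((k : ℝ) + 1) * (2 * d - α) - 2 * d + 1) q := by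
  have h := succ_mul_sub_pos hα hd k
  have h1 := rise_add (((k : ℝ) + 1) * (2 * d - α) - 2 * d + 1) q (2 * d - 1)
  rw [add_comm q, rise_add] at h1
  have h2 : ((2 * d - 1 : ℕ) : ℝ) = 2 * d - 1 := by
    rw [Nat.cast_sub (by omega)]; push_cast; ring
  rw [h2, show ((k : ℝ) + 1) * (2 * d - α) - 2 * d + 1 + (2 * d - 1)
    = ((k : ℝ) + 1) * (2 * d - α) by ring] at h1
  rw [growth, div_eq_div_iff (rise_pos h _).ne' (rise_pos h _).ne']
  linarith

lemma growth_eq_inv_betaMoment (hα : α < 1) (hd : 1 ≤ d) (k q : ℕ) :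
    growth α d k q = (betaMoment α d q k)⁻¹ := by
  rw [growth_eq hα hd, betaMoment, inv_div]

/-- Dividing every factor by A turns the base points into the gamma parameters of Z', shifted by k.
The product is reversed to match their numbering. -/
lemma growth_eq_prod (hα : α < 1) (hd : 1 ≤ d) (k q : ℕ) :
    growth α d k q = ∏ i ∈ Finset.range (2 * d - 1),
      ((1 - ((i : ℝ) + 1) / (2 * d - α) + q / (2 * d - α) + k)
        / (1 - ((i : ℝ) + 1) / (2 * d - α) + k)) := by
  have hA := two_mul_sub_pos hα hd
  rw [growth, rise, rise, ← Finset.prod_div_distrib, ← Finset.prod_range_reflect]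
  refine Finset.prod_congr rfl fun i hi => ?_
  have hi' := Finset.mem_range.1 hi
  have h2 : ((2 * d - 1 - 1 - i : ℕ) : ℝ) = 2 * d - 2 - i := by
    rw [Nat.cast_sub (by omega), Nat.cast_sub (by omega), Nat.cast_sub (by omega)]
    push_cast; ring
  rw [h2]
  have e1 : ((k : ℝ) + 1) * (2 * d - α) - 2 * d + 1 + q + (2 * d - 2 - i)
    = (2 * d - α) * (1 - ((i : ℝ) + 1) / (2 * d - α) + q / (2 * d - α) + k) := by
    field_simp; ring
  have e2 : ((k : ℝ) + 1) * (2 * d - α) - 2 * d + 1 + (2 * d - 2 - i)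
    = (2 * d - α) * (1 - ((i : ℝ) + 1) / (2 * d - α) + k) := by
    field_simp; ring
  rw [e1, e2, mul_div_mul_left _ _ hA.ne']

/-- The mixed moments of `G_{r(2d-α)} V_r`. -/
lemma rise_mul_prod_sliceMoment (hα : α < 1) (hd : 1 ≤ d) (p : ℕ → ℕ) (r : ℕ) (hr : 1 ≤ r) :
    rise (r * (2 * d - α)) (∑ i ∈ Finset.range r, p i)
        * ∏ j ∈ Finset.range r, sliceMoment α d p j
      = ∏ k ∈ Finset.range r,
        (rise (1 - α) (p k) * growth α d k (∑ i ∈ Finset.range (k + 1), p i)) := by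
  have hA := two_mul_sub_pos hα hd
  induction r, hr using Nat.le_induction with
  | base =>
    simp only [Finset.prod_range_one, sliceMoment, growth_eq hα hd]
    simp only [Finset.sum_range_one, if_true, Nat.cast_one, Nat.cast_zero, zero_add, one_mul,
      mul_one]
    rw [show 2 * (d : ℝ) - α - 2 * d + 1 = 1 - α by ring]
    have := (rise_pos (show 0 < 1 - α by linarith) (p 0)).ne'
    field_simp
  | succ r hr ih =>
    -- The numerator of the new slice contains the rising factorial of rA that stood in front at
    -- stage r, so the product telescopes.
    rw [Finset.prod_range_succ, Finset.prod_range_succ _ r, ← ih, sliceMoment, if_neg (by omega),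
      growth_eq hα hd]
    have := (rise_pos (succ_mul_sub_pos hα hd r) (∑ i ∈ Finset.range (r + 1), p i)).ne'
    push_cast
    field_simp

/-- Raising every gamma parameter by one applies Γ(x + 1) = xΓ(x) in numerator and denominator; the
extra ratios are those of `growth_eq_prod`. -/
lemma integral_pow_lawZ_succ (hα : α < 1) (hd : 1 ≤ d) (r n : ℕ) :
    ∫ x, x ^ n ∂lawZ α d (r + 1) = (∫ x, x ^ n ∂lawZ α d r) * growth α d r n := by
  have hA := two_mul_sub_pos hα hd
  rw [lawZ, lawZ, integral_pow_gammaPowLaw hα hd (le_add_of_nonneg_left (Nat.cast_nonneg _)),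
    integral_pow_gammaPowLaw hα hd (by simp),
    growth_eq_prod hα hd, ← Finset.prod_mul_distrib]
  refine Finset.prod_congr rfl fun i hi => ?_
  have hi := div_lt_one_of_lt_two_mul hα hd (Finset.mem_range.1 hi)
  have h1 : 0 < (r : ℝ) + 1 - (i + 1) / (2 * d - α) := by
    have : (0 : ℝ) ≤ r := r.cast_nonneg
    linarith
  have h2 : 0 < (r : ℝ) + 1 - (i + 1) / (2 * d - α) + n / (2 * d - α) := by positivity
  push_cast
  rw [show (r : ℝ) + 1 + 1 - (i + 1) / (2 * d - α) + n / (2 * d - α)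
      = (r : ℝ) + 1 - (i + 1) / (2 * d - α) + n / (2 * d - α) + 1 by ring,
    show (r : ℝ) + 1 + 1 - (i + 1) / (2 * d - α) = (r : ℝ) + 1 - (i + 1) / (2 * d - α) + 1 by ring,
    Real.Gamma_add_one h1.ne', Real.Gamma_add_one h2.ne', mul_comm _ (Real.Gamma _),
    mul_comm _ (Real.Gamma (_ - _)), mul_div_mul_comm]
  congr 2 <;> ring

/-- The moments of `Z_r` in terms of those of `Z'_r`. -/
lemma integral_pow_lawZ (hα : α < 1) (hd : 1 ≤ d) (r n : ℕ) :
    ∫ x, x ^ n ∂lawZ α d r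
      = (∫ x, x ^ n ∂lawZ' α d) * ∏ k ∈ Finset.range r, growth α d k n := by
  induction r with
  | zero => simp [lawZ, lawZ']
  | succ r ih => rw [integral_pow_lawZ_succ hα hd, ih, Finset.prod_range_succ, mul_assoc]

/-- The moments of the two radial laws that pair with `Z'_r` agree. -/
lemma rise_mul_prod_betaMoment (hα : α < 1) (hd : 1 ≤ d) (n : ℕ) {r : ℕ} (hr : 1 ≤ r) :
    rise (r * (2 * d - α) - 2 * d + 1) n * ∏ k ∈ Finset.range (r - 1), betaMoment α d n k
      = rise (r * (2 * d - α)) n * ∏ k ∈ Finset.range r, betaMoment α d n k := by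
  have hA := two_mul_sub_pos hα hd
  obtain ⟨r, rfl⟩ := Nat.exists_eq_add_of_le' hr
  rw [Nat.add_sub_cancel, Finset.prod_range_succ, betaMoment]
  have := (rise_pos (show 0 < ((r : ℝ) + 1) * (2 * d - α) by positivity) n).ne'
  push_cast
  field_simp

/-- The two families of beta moments interlace: rise(kA - 2d + 1)/rise(kA) times
rise(kA)/rise((k+1)A - 2d + 1) telescopes down to the base point A - 2d + 1 = 1 - α. -/
lemma prod_betaMoment_mul_ratio (hα : α < 1) (hd : 1 ≤ d) (n : ℕ) {r : ℕ} (hr : 1 ≤ r) :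
    (rise (r * (2 * d - α)) n * ∏ k ∈ Finset.range r, betaMoment α d n k)
        * ∏ k ∈ Finset.range (r - 1), (rise (((k : ℝ) + 1) * (2 * d - α)) n
          / rise (((k : ℝ) + 2) * (2 * d - α) - 2 * d + 1) n)
      = rise (1 - α) n := by
  have hA := two_mul_sub_pos hα hd
  rw [← rise_mul_prod_betaMoment hα hd n hr]
  induction r, hr using Nat.le_induction with
  | base => simp; congr 1; ring
  | succ r hr ih =>
    obtain ⟨s, rfl⟩ := Nat.exists_eq_add_of_le' hr
    rw [← ih]
    simp only [Nat.add_sub_cancel]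
    rw [Finset.prod_range_succ, Finset.prod_range_succ, betaMoment]
    have h1 := (rise_pos (show 0 < ((s : ℝ) + 1) * (2 * d - α) by positivity) n).ne'
    have h2 := (rise_pos (succ_mul_sub_pos hα hd (s + 1)) n).ne'
    push_cast at h2 ⊢
    rw [show (s : ℝ) + 2 = s + 1 + 1 by ring]
    field_simp

/-! ### The distributional identities from the moments of the limit -/

/-- The value of `E[Z'^P] E[∏ ξ_j^{p_j}]`, where `P` is the sum of the `p_j`. -/
noncomputable def limitMoment (α : ℝ) (d r : ℕ) (p : ℕ → ℕ) : ℝ :=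
  ∏ k ∈ Finset.range r, (rise (1 - α) (p k) * growth α d k (∑ i ∈ Finset.range (k + 1), p i)
    / growth α d k (∑ i ∈ Finset.range r, p i))

lemma sliceMoment_pos (hα : α < 1) (hd : 1 ≤ d) (p : ℕ → ℕ) (j : ℕ) : 0 < sliceMoment α d p j := by
  unfold sliceMoment
  split_ifs with h
  · exact one_pos
  · have : 0 < j := Nat.pos_of_ne_zero h
    have := two_mul_sub_pos hα hd
    exact div_pos (mul_pos (rise_pos (by linarith) _) (rise_pos (by positivity) _))
      (rise_pos (succ_mul_sub_pos hα hd j) _)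

lemma limitMoment_eq (hα : α < 1) (hd : 1 ≤ d) {r : ℕ} (hr : 1 ≤ r) (p : ℕ → ℕ) :
    limitMoment α d r p = (rise (r * (2 * d - α)) (∑ i ∈ Finset.range r, p i)
        * ∏ k ∈ Finset.range r, betaMoment α d (∑ i ∈ Finset.range r, p i) k)
      * ∏ j ∈ Finset.range r, sliceMoment α d p j := by
  rw [mul_right_comm, rise_mul_prod_sliceMoment hα hd p r hr, limitMoment,
    ← Finset.prod_mul_distrib]
  refine Finset.prod_congr rfl fun k _ => ?_
  rw [growth_eq_inv_betaMoment hα hd k (∑ i ∈ Finset.range r, p i), div_inv_eq_mul]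

/-- A radial law whose moments are matched gives the distributional identity. -/
lemma scaledLaw_eq_stickLaw (hα : α < 1) (hd : 1 ≤ d) {r : ℕ} {ρ : Measure (Fin r → ℝ)}
    [IsProbabilityMeasure ρ] (hρ : ∀ᵐ x ∂ρ, ∀ j, 0 ≤ x j) {ν ν' : Measure ℝ}
    [IsProbabilityMeasure ν] [IsProbabilityMeasure ν'] (hν : ∀ᵐ x ∂ν, 0 ≤ x)
    (hν' : ∀ᵐ x ∂ν', 0 ≤ x) {a : ℝ} (ha : 0 < a) {w : ℕ → ℝ} (hw0 : ∀ n, 0 < w n)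
    (hw1 : ∀ n, w n ≤ 1) (hνw : ∀ n, ∫ x, x ^ n ∂ν' = rise a n * w n)
    (h : ∀ p : ℕ → ℕ, (∀ j, r ≤ j → p j = 0) →
      (∫ x, x ^ (∑ i ∈ Finset.range r, p i) ∂ν) * ∫ x, ∏ j : Fin r, x j ^ p j ∂ρ
        = (∫ x, x ^ (∑ i ∈ Finset.range r, p i) ∂ν')
          * ∏ j ∈ Finset.range r, sliceMoment α d p j) :
    scaledLaw ν ρ = scaledLaw ν' (stickLaw α d r) := by
  have := isProbabilityMeasure_stickLaw hα hd r
  -- Exponents are extended by zero, so that partial sums can be taken over ranges of naturals.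
  let e : (Fin r → ℕ) → ℕ → ℕ := fun p j => if h : j < r then p ⟨j, h⟩ else 0
  have he : ∀ (p : Fin r → ℕ) (j : Fin r), e p j = p j := fun p j => by simp [e]
  have hst : ∀ p : Fin r → ℕ, ∫ x, ∏ j, x j ^ p j ∂stickLaw α d r
      = ∏ j ∈ Finset.range r, sliceMoment α d (e p) j := fun p => by
    rw [← integral_stickLaw hα hd]; simp_rw [he]
  refine scaledLaw_eq_of_moments hν hρ hν'
    ((ae_stickLaw_mem hα hd r).mono fun x hx j => (hx j).1) (fun p => ?_) (fun n => ?_)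
    (fun p => ?_) (C := max a 1) (by positivity) (fun n => ?_)
    fun p => integral_stickLaw_le_one hα hd p
  · have := h (e p) fun j hj => by simp [e, not_lt.2 hj]
    rw [Finset.sum_range] at this
    simp_rw [he] at this
    rw [this, hst]
  · rw [hνw]; exact mul_pos (rise_pos ha n) (hw0 n)
  · rw [hst]; exact Finset.prod_pos fun j _ => sliceMoment_pos hα hd _ j
  · rw [hνw]
    exact (mul_le_of_le_one_right (rise_pos ha n).le (hw1 n)).trans
      (rise_le_pow_mul_factorial ha (le_max_right _ _) (le_max_left _ _) n)

/-- With `limitMoment_eq` the second identity is immediate. The third rewrites its radial moment,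
the first multiplies by the growth factors that cancel the beta moments, and the fourth by the
moments of the extra beta variables. -/
theorem scaledLaw_identities (hα : α < 1) (hd : 1 ≤ d) {r : ℕ} (hr : 1 ≤ r)
    {ρ : Measure (Fin r → ℝ)} [IsProbabilityMeasure ρ] (hρ : ∀ᵐ x ∂ρ, ∀ j, 0 ≤ x j)
    (h : ∀ p : ℕ → ℕ, (∀ j, r ≤ j → p j = 0) →
      (∫ x, x ^ (∑ i ∈ Finset.range r, p i) ∂lawZ' α d) * ∫ x, ∏ j : Fin r, x j ^ p j ∂ρ
        = limitMoment α d r p) :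
    scaledLaw (lawZ α d r) ρ
        = scaledLaw (gammaMeasure (r * (2 * d - α)) 1) (stickLaw α d r) ∧
      scaledLaw (lawZ' α d) ρ
        = scaledLaw (Measure.mconv (gammaMeasure (r * (2 * d - α)) 1) (betaProdLaw α d r))
          (stickLaw α d r) ∧
      scaledLaw (lawZ' α d) ρ
        = scaledLaw (Measure.mconv (gammaMeasure (r * (2 * d - α) - 2 * d + 1) 1)
            (betaProdLaw α d (r - 1))) (stickLaw α d r) ∧
      scaledLaw (lawZ'' α d r) ρ = scaledLaw (gammaMeasure (1 - α) 1) (stickLaw α d r) := by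
  have hA := two_mul_sub_pos hα hd
  have hr0 : (0 : ℝ) < r := by exact_mod_cast hr
  have ha1 : 0 < (r : ℝ) * (2 * d - α) := by positivity
  have ha2 : 0 < (r : ℝ) * (2 * d - α) - 2 * d + 1 := by
    have := succ_mul_sub_pos hα hd (r - 1)
    rwa [Nat.cast_sub hr, Nat.cast_one, sub_add_cancel] at this
  have ha3 : 0 < 1 - α := by linarith
  have := isProbabilityMeasure_gammaMeasure ha1 one_pos
  have := isProbabilityMeasure_gammaMeasure ha2 one_pos
  have := isProbabilityMeasure_gammaMeasure ha3 one_pos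
  have := isProbabilityMeasure_betaProdLaw hα hd r
  have := isProbabilityMeasure_betaProdLaw hα hd (r - 1)
  have := isProbabilityMeasure_ratioProdLaw hα hd r
  have hZp : IsProbabilityMeasure (lawZ α d r) := isProbabilityMeasure_gammaPowLaw hα hd (by simp)
  have hZp' : IsProbabilityMeasure (lawZ' α d) := isProbabilityMeasure_gammaPowLaw hα hd le_rfl
  have hZ : ∀ᵐ x ∂lawZ α d r, 0 ≤ x := ae_gammaPowLaw_nonneg hα hd (by simp)
  have hZ' : ∀ᵐ x ∂lawZ' α d, 0 ≤ x := ae_gammaPowLaw_nonneg hα hd le_rfl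
  have hZ'' : lawZ'' α d r = Measure.mconv (lawZ' α d) (ratioProdLaw α d r) := rfl
  have hw0 : ∀ m n, 0 < ∏ k ∈ Finset.range m, betaMoment α d n k := fun m n =>
    Finset.prod_pos fun k _ => betaMoment_pos hα hd n k
  have hw1 : ∀ m n, ∏ k ∈ Finset.range m, betaMoment α d n k ≤ 1 := fun m n =>
    Finset.prod_le_one (fun k _ => (betaMoment_pos hα hd n k).le)
      fun k _ => betaMoment_le_one hα hd n k
  refine ⟨?_, ?_, ?_, ?_⟩
  · refine scaledLaw_eq_stickLaw hα hd hρ hZ (ae_gammaMeasure_nonneg _ _) ha1 (w := fun _ => 1)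
      (fun _ => one_pos) (fun _ => le_rfl)
      (fun n => by rw [integral_pow_gammaMeasure ha1, mul_one]) fun p hp => ?_
    have hG : ∀ n, (∏ k ∈ Finset.range r, betaMoment α d n k)
        * ∏ k ∈ Finset.range r, growth α d k n = 1 := fun n => by
      rw [← Finset.prod_mul_distrib]
      refine Finset.prod_eq_one fun k _ => ?_
      rw [growth_eq_inv_betaMoment hα hd, mul_inv_cancel₀ (betaMoment_pos hα hd n k).ne']
    rw [integral_pow_lawZ hα hd, mul_right_comm, h p hp, limitMoment_eq hα hd hr,
      integral_pow_gammaMeasure ha1, mul_right_comm, mul_assoc (rise _ _), hG, mul_one]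
  · refine scaledLaw_eq_stickLaw hα hd hρ hZ'
      (ae_mconv_nonneg _ _ (ae_gammaMeasure_nonneg _ _) (ae_betaProdLaw_nonneg hα hd r)) ha1
      (hw0 r) (hw1 r) (fun n => by
        rw [integral_pow_mconv, integral_pow_gammaMeasure ha1, integral_pow_betaProdLaw hα hd])
      fun p hp => ?_
    rw [h p hp, limitMoment_eq hα hd hr, integral_pow_mconv, integral_pow_gammaMeasure ha1,
      integral_pow_betaProdLaw hα hd]
  · refine scaledLaw_eq_stickLaw hα hd hρ hZ'
      (ae_mconv_nonneg _ _ (ae_gammaMeasure_nonneg _ _) (ae_betaProdLaw_nonneg hα hd _)) ha2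
      (hw0 (r - 1)) (hw1 (r - 1)) (fun n => by
        rw [integral_pow_mconv, integral_pow_gammaMeasure ha2, integral_pow_betaProdLaw hα hd])
      fun p hp => ?_
    rw [h p hp, limitMoment_eq hα hd hr, integral_pow_mconv, integral_pow_gammaMeasure ha2,
      integral_pow_betaProdLaw hα hd, rise_mul_prod_betaMoment hα hd _ hr]
  · rw [hZ'']
    refine scaledLaw_eq_stickLaw hα hd hρ
      (ae_mconv_nonneg _ _ hZ' (ae_ratioProdLaw_nonneg hα hd r)) (ae_gammaMeasure_nonneg _ _) ha3
      (w := fun _ => 1) (fun _ => one_pos) (fun _ => le_rfl)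
      (fun n => by rw [integral_pow_gammaMeasure ha3, mul_one]) fun p hp => ?_
    rw [integral_pow_mconv, mul_right_comm, h p hp, limitMoment_eq hα hd hr,
      integral_pow_ratioProdLaw hα hd, mul_right_comm, prod_betaMoment_mul_ratio hα hd _ hr,
      integral_pow_gammaMeasure ha3]

end Model

/-! ### Deterministic facts about label sequences -/

lemma deg_succ (l : ℕ → ℕ) (k n : ℕ) :
    deg l k (n + 1) = deg l k n + if l (n + 1) = k then 1 else 0 := by
  unfold deg
  rw [← Finset.insert_Icc_right_eq_Icc_add_one (by omega), Finset.filter_insert]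
  split_ifs
  · rw [Finset.card_insert_of_notMem (by simp)]
  · simp

@[simp] lemma deg_zero (l : ℕ → ℕ) (k : ℕ) : deg l k 0 = 0 := by simp [deg]

lemma deg_mono (l : ℕ → ℕ) (k : ℕ) : Monotone (deg l k) :=
  monotone_nat_of_le_succ fun n => by rw [deg_succ]; exact Nat.le_add_right _ _

lemma maxLabel_succ (l : ℕ → ℕ) (n : ℕ) : maxLabel l (n + 1) = max (l (n + 1)) (maxLabel l n) := by
  unfold maxLabel
  rw [← Finset.insert_Icc_right_eq_Icc_add_one (by omega), Finset.sup_insert]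

@[simp] lemma maxLabel_zero (l : ℕ → ℕ) : maxLabel l 0 = 0 := by simp [maxLabel]

section Congr

variable {l l' : ℕ → ℕ} {n : ℕ}

lemma deg_congr (h : ∀ i ∈ Finset.Icc 1 n, l i = l' i) (k : ℕ) : deg l k n = deg l' k n := by
  unfold deg
  rw [Finset.filter_congr fun i hi => by rw [h i hi]]

lemma stepProb_congr (α : ℝ) (t : ℕ → ℕ∞) (h : ∀ i ∈ Finset.Icc 1 n, l i = l' i) (k : ℕ) :
    stepProb α t l n k = stepProb α t l' n k := by
  have : maxLabel l n = maxLabel l' n := Finset.sup_congr rfl h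
  rw [stepProb, stepProb, degreeBiased, degreeBiased, deg_congr h, this]

end Congr

/-- The label sequences charged by the model in which a vertex arrives every `m` edge ends. -/
def Admissible (m : ℕ) (l : ℕ → ℕ) (n : ℕ) : Prop :=
  ∀ i < n, 1 ≤ l (i + 1) ∧ l (i + 1) ≤ i / m + 1 ∧ (m ∣ i → l (i + 1) = i / m + 1)

section Admissible

variable {m : ℕ} {l : ℕ → ℕ} {n : ℕ}

lemma Admissible.mono {k : ℕ} (h : Admissible m l n) (hk : k ≤ n) : Admissible m l k :=
  fun i hi => h i (hi.trans_le hk)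

lemma Admissible.maxLabel_succ (h : Admissible m l (n + 1)) : maxLabel l (n + 1) = n / m + 1 := by
  induction n with
  | zero => rw [PrefAttach.maxLabel_succ, (h 0 (by omega)).2.2 (by simp)]; simp
  | succ n ih =>
    rw [PrefAttach.maxLabel_succ, ih (h.mono (by omega))]
    obtain ⟨-, h2, h3⟩ := h (n + 1) (by omega)
    have hs := Nat.succ_div (a := n) (b := m)
    by_cases hd : m ∣ n + 1
    · rw [h3 hd]; rw [if_pos hd] at hs; omega
    · rw [if_neg hd] at hs; omega

lemma Admissible.deg_eq_zero (h : Admissible m l n) {k : ℕ} (hk : n ≤ m * k) :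
    deg l (k + 1) n = 0 := by
  induction n with
  | zero => simp
  | succ n ih =>
    rw [deg_succ, ih (h.mono (by omega)) (by omega), if_neg]
    have h2 := (h n (by omega)).2.1
    have : n / m < k := Nat.div_lt_of_lt_mul (by omega)
    omega

lemma Admissible.deg_pos (hm : 0 < m) (h : Admissible m l n) {k : ℕ} (hk : m * k < n) :
    0 < deg l (k + 1) n := by
  refine lt_of_lt_of_le ?_ (deg_mono l (k + 1) (show m * k + 1 ≤ n by omega))
  rw [deg_succ, (h (m * k) hk).2.2 (dvd_mul_right m k), Nat.mul_div_cancel_left _ hm]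
  simp

lemma Admissible.sum_deg (h : Admissible m l n) {K : ℕ} (hK : ∀ i < n, i / m < K) :
    ∑ k ∈ Finset.range K, deg l (k + 1) n = n := by
  induction n with
  | zero => simp
  | succ n ih =>
    simp_rw [deg_succ]
    rw [Finset.sum_add_distrib, ih (h.mono (by omega)) fun i hi => hK i (by omega)]
    obtain ⟨h1, h2, -⟩ := h n (by omega)
    have := hK n (by omega)
    rw [Finset.sum_eq_single (l (n + 1) - 1)]
    · rw [if_pos (by omega)]
    · intro b _ hb; rw [if_neg (by omega)]
    · intro hb; rw [Finset.mem_range] at hb; omega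

end Admissible

/-! ### Mixed rising factorials of the degrees -/

/-- `(x - α) (x - α + 1) ⋯ (x - α + q - 1)`, or `1` for a vertex of degree `x = 0`. -/
noncomputable def degRise (α : ℝ) (q x : ℕ) : ℝ := if x = 0 then 1 else rise ((x : ℝ) - α) q

lemma degRise_zero_left (α : ℝ) (x : ℕ) : degRise α 0 x = 1 := by simp [degRise]

lemma natCast_sub_pos {α : ℝ} (hα : α < 1) {x : ℕ} (hx : x ≠ 0) : 0 < (x : ℝ) - α := by
  have : (1 : ℝ) ≤ x := by exact_mod_cast Nat.one_le_iff_ne_zero.2 hx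
  linarith

lemma degRise_pos {α : ℝ} (hα : α < 1) (q x : ℕ) : 0 < degRise α q x := by
  unfold degRise
  split_ifs with h
  · exact one_pos
  · exact rise_pos (natCast_sub_pos hα h) q

lemma degRise_succ {α : ℝ} (hα : α < 1) (q : ℕ) {x : ℕ} (hx : x ≠ 0) :
    degRise α q (x + 1) = degRise α q x * (((x : ℝ) - α + q) / (x - α)) := by
  have h := natCast_sub_pos hα hx
  have h1 := rise_add ((x : ℝ) - α) 1 q
  rw [add_comm 1 q, rise_succ, rise_one] at h1
  rw [degRise, degRise, if_neg (by omega), if_neg hx]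
  push_cast at h1 ⊢
  rw [show (x : ℝ) + 1 - α = x - α + 1 by ring]
  field_simp
  linarith

/-- The second half of a rising factorial of length 2q dominates the first; this supplies the
second-moment bounds. -/
lemma degRise_sq_le {α : ℝ} (hα : α < 1) (q x : ℕ) : degRise α q x ^ 2 ≤ degRise α (2 * q) x := by
  unfold degRise
  split_ifs with h
  · simp
  · have h0 := natCast_sub_pos hα h
    rw [two_mul, rise_add, sq]
    refine mul_le_mul_of_nonneg_left ?_ (rise_pos h0 q).le
    refine Finset.prod_le_prod (fun i _ => by positivity) fun i _ => ?_
    have : (0 : ℝ) ≤ q := q.cast_nonneg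
    linarith

/-- The mixed rising factorial of the degrees of the vertices `1, …, r` after `n` edge ends. -/
noncomputable def mixedRise (α : ℝ) (r : ℕ) (p : ℕ → ℕ) (l : ℕ → ℕ) (n : ℕ) : ℝ :=
  ∏ j ∈ Finset.range r, degRise α (p j) (deg l (j + 1) n)

/-- The conditional expectation of the growth of `mixedRise` at the edge end `n + 1`. -/
noncomputable def stepGrowth (α : ℝ) (m : ℕ) (p : ℕ → ℕ) (n : ℕ) : ℝ :=
  if m ∣ n then rise (1 - α) (p (n / m)) else
    ((n : ℝ) - α * (n / m + 1 : ℕ) + ∑ i ∈ Finset.range (n / m + 1), (p i : ℝ))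
      / ((n : ℝ) - α * (n / m + 1 : ℕ))

section MixedRise

variable {α : ℝ} {m r : ℕ} {p l : ℕ → ℕ} {n : ℕ}

lemma mixedRise_pos (hα : α < 1) : 0 < mixedRise α r p l n :=
  Finset.prod_pos fun _ _ => degRise_pos hα _ _

@[simp] lemma mixedRise_zero : mixedRise α r p l 0 = 1 := by simp [mixedRise, degRise]

lemma mixedRise_sq_le (hα : α < 1) :
    mixedRise α r p l n ^ 2 ≤ mixedRise α r (fun j => 2 * p j) l n := by
  rw [mixedRise, ← Finset.prod_pow]
  exact Finset.prod_le_prod (fun _ _ => by positivity) fun j _ => degRise_sq_le hα _ _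

lemma mixedRise_congr {l' : ℕ → ℕ} (h : ∀ i ∈ Finset.Icc 1 n, l i = l' i) :
    mixedRise α r p l n = mixedRise α r p l' n := by
  unfold mixedRise
  simp_rw [deg_congr h]

/-- Only the factor of the chosen vertex changes. For a vertex beyond r the exponent is 0, and `hc1`
then forces the factor c to be 1. -/
lemma mixedRise_succ (hp : ∀ j, r ≤ j → p j = 0) {k : ℕ} (hk : l (n + 1) = k + 1) {c : ℝ}
    (hc : degRise α (p k) (deg l (k + 1) n + 1) = degRise α (p k) (deg l (k + 1) n) * c)
    (hc1 : p k = 0 → c = 1) :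
    mixedRise α r p l (n + 1) = mixedRise α r p l n * c := by
  have h0 : ∀ j, j ≠ k → deg l (j + 1) (n + 1) = deg l (j + 1) n := fun j hj => by
    rw [deg_succ, if_neg (by omega), add_zero]
  have h1 : deg l (k + 1) (n + 1) = deg l (k + 1) n + 1 := by rw [deg_succ, if_pos hk]
  unfold mixedRise
  by_cases hkr : k < r
  · rw [← Finset.mul_prod_erase _ _ (Finset.mem_range.2 hkr),
      ← Finset.mul_prod_erase _ _ (Finset.mem_range.2 hkr), h1, hc, mul_right_comm]
    congr 2
    refine Finset.prod_congr rfl fun j hj => ?_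
    rw [h0 j (Finset.ne_of_mem_erase hj)]
  · rw [hc1 (hp k (not_lt.1 hkr)), mul_one]
    refine Finset.prod_congr rfl fun j hj => ?_
    rw [h0 j (by rintro rfl; exact hkr (Finset.mem_range.1 hj))]

lemma mixedRise_succ_of_arrival (hp : ∀ j, r ≤ j → p j = 0)
    (h : Admissible m l n) (hn : m ∣ n) (hl : l (n + 1) = n / m + 1) :
    mixedRise α r p l (n + 1) = mixedRise α r p l n * rise (1 - α) (p (n / m)) := by
  have h0 : deg l (n / m + 1) n = 0 := h.deg_eq_zero (Nat.mul_div_cancel' hn).ge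
  refine mixedRise_succ hp hl ?_ fun h => by rw [h, rise_zero]
  rw [h0]; simp [degRise]

lemma mixedRise_succ_of_not_arrival (hα : α < 1) (hp : ∀ j, r ≤ j → p j = 0) {k : ℕ}
    (hk : deg l (k + 1) n ≠ 0) (hl : l (n + 1) = k + 1) :
    mixedRise α r p l (n + 1) = mixedRise α r p l n
      * (((deg l (k + 1) n : ℝ) - α + p k) / ((deg l (k + 1) n : ℝ) - α)) := by
  refine mixedRise_succ hp hl (degRise_succ hα _ hk) fun h => ?_
  rw [h, Nat.cast_zero, add_zero, div_self (natCast_sub_pos hα hk).ne']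

/-- Away from arrival times there are at most as many vertices as edge ends, and α < 1. -/
lemma not_dvd_denominator_pos (hα : α < 1) (hm : 2 ≤ m) (hn : ¬ m ∣ n) :
    0 < (n : ℝ) - α * (n / m + 1 : ℕ) := by
  have h1 : n / m + 1 ≤ n := by
    have h0 : n ≠ 0 := by rintro rfl; exact hn (dvd_zero _)
    have := Nat.div_lt_self (Nat.pos_of_ne_zero h0) (show 1 < m by omega)
    omega
  have h2 : ((n / m + 1 : ℕ) : ℝ) ≤ n := by exact_mod_cast h1
  have h3 : (0 : ℝ) < (n / m + 1 : ℕ) := by positivity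
  nlinarith

lemma stepGrowth_pos (hα : α < 1) (hm : 2 ≤ m) : 0 < stepGrowth α m p n := by
  unfold stepGrowth
  split_ifs with h
  · exact rise_pos (by linarith) _
  · have := not_dvd_denominator_pos hα hm h
    exact div_pos (add_pos_of_pos_of_nonneg this (by positivity)) this

end MixedRise

/-! ### The transition probabilities with regular arrivals -/

section Step

variable {α : ℝ} {m : ℕ} {t : ℕ → ℕ∞} {l : ℕ → ℕ} {n : ℕ}

lemma exists_arrival_iff
    (ht : ∀ j, 1 ≤ j → t j = ((m * (j - 1) + 1 : ℕ) : ℕ∞)) :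
    (∃ j, 1 ≤ j ∧ t j = ((n + 1 : ℕ) : ℕ∞)) ↔ m ∣ n := by
  constructor
  · rintro ⟨j, hj, h⟩
    rw [ht j hj, Nat.cast_inj] at h
    exact ⟨j - 1, by omega⟩
  · rintro ⟨k, rfl⟩
    exact ⟨k + 1, by omega, by rw [ht _ (by omega)]; simp⟩

lemma stepProb_of_dvd (hm : 0 < m) (ht : ∀ j, 1 ≤ j → t j = ((m * (j - 1) + 1 : ℕ) : ℕ∞))
    (hn : m ∣ n) (k : ℕ) : stepProb α t l n k = if k = n / m + 1 then 1 else 0 := by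
  rw [stepProb, if_pos ((exists_arrival_iff ht).2 hn)]
  refine if_congr ?_ rfl rfl
  constructor
  · rintro ⟨hk, h⟩
    rw [ht k hk, Nat.cast_inj] at h
    have : n = m * (k - 1) := by omega
    rw [this, Nat.mul_div_cancel_left _ hm]; omega
  · rintro rfl
    exact ⟨Nat.le_add_left 1 _, by
      rw [ht _ (Nat.le_add_left 1 _), Nat.add_sub_cancel, Nat.mul_div_cancel' hn]⟩

lemma stepProb_of_not_dvd (ht : ∀ j, 1 ≤ j → t j = ((m * (j - 1) + 1 : ℕ) : ℕ∞))
    (hn : ¬ m ∣ n) (k : ℕ) : stepProb α t l n k = degreeBiased α l n k := by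
  rw [stepProb, if_neg (mt (exists_arrival_iff ht).1 hn)]

lemma Admissible.maxLabel_of_not_dvd (h : Admissible m l n) (hn : ¬ m ∣ n) :
    maxLabel l n = n / m + 1 := by
  obtain _ | n := n
  · exact absurd (dvd_zero _) hn
  · rw [h.maxLabel_succ, Nat.succ_div, if_neg hn, add_zero]

/-- By induction, since the range of allowed labels is known only once the past is admissible. -/
lemma admissible_of_stepProb_ne_zero (hm : 0 < m)
    (ht : ∀ j, 1 ≤ j → t j = ((m * (j - 1) + 1 : ℕ) : ℕ∞))
    (h : ∀ n, stepProb α t l n (l (n + 1)) ≠ 0) (n : ℕ) : Admissible m l n := by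
  induction n with
  | zero => intro i hi; omega
  | succ n ih =>
    intro i hi
    rcases Nat.lt_succ_iff_lt_or_eq.1 hi with hi | rfl
    · exact ih i hi
    · have hn := h i
      by_cases hd : m ∣ i
      · rw [stepProb_of_dvd hm ht hd] at hn
        have : l (i + 1) = i / m + 1 := by
          by_contra hne
          exact hn (if_neg hne)
        exact ⟨this ▸ Nat.le_add_left 1 _, this.le, fun _ => this⟩
      · rw [stepProb_of_not_dvd ht hd, degreeBiased] at hn
        have : 1 ≤ l (i + 1) ∧ l (i + 1) ≤ maxLabel l i := by
          by_contra hne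
          exact hn (if_neg hne)
        rw [ih.maxLabel_of_not_dvd hd] at this
        exact ⟨this.1, this.2, fun h => absurd h hd⟩

/-- One step of the model multiplies the mean of `mixedRise` by `stepGrowth`. -/
lemma tsum_mixedRise_mul_stepProb (hα : α < 1) (hm : 2 ≤ m)
    (ht : ∀ j, 1 ≤ j → t j = ((m * (j - 1) + 1 : ℕ) : ℕ∞)) {r : ℕ} {p : ℕ → ℕ}
    (hp : ∀ j, r ≤ j → p j = 0) (h : Admissible m l n) :
    ∑' k, ENNReal.ofReal (mixedRise α r p (Function.update l (n + 1) k) (n + 1))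
        * ENNReal.ofReal (stepProb α t l n k)
      = ENNReal.ofReal (stepGrowth α m p n * mixedRise α r p l n) := by
  have hm0 : 0 < m := by omega
  have hup : ∀ k, ∀ i ∈ Finset.Icc 1 n, Function.update l (n + 1) k i = l i := fun k i hi => by
    rw [Function.update_of_ne]
    have := (Finset.mem_Icc.1 hi).2
    omega
  have hA : ∀ k, Admissible m (Function.update l (n + 1) k) n := fun k i hi => by
    rw [hup k (i + 1) (Finset.mem_Icc.2 ⟨by omega, by omega⟩)]
    exact h i hi
  by_cases hd : m ∣ n
  · simp_rw [stepProb_of_dvd hm0 ht hd]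
    rw [tsum_eq_single (n / m + 1) fun k hk => by rw [if_neg hk]; simp, if_pos rfl,
      ENNReal.ofReal_one, mul_one,
      mixedRise_succ_of_arrival hp (hA _) hd (Function.update_self ..),
      mixedRise_congr (hup _), stepGrowth, if_pos hd, mul_comm]
  · have hK := h.maxLabel_of_not_dvd hd
    have hden := not_dvd_denominator_pos hα hm hd
    have hdeg : ∀ k ∈ Finset.range (n / m + 1), deg l (k + 1) n ≠ 0 := fun k hk => by
      refine (h.deg_pos hm0 ?_).ne'
      have h1 : k ≤ n / m := Nat.lt_succ_iff.1 (Finset.mem_range.1 hk)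
      have h2 : m * k ≤ n := (Nat.mul_le_mul_left m h1).trans (Nat.mul_div_le n m)
      exact lt_of_le_of_ne h2 fun h3 => hd ⟨k, h3.symm⟩
    -- The factor deg - α of the probability cancels the denominator of the growth of `mixedRise`,
    -- leaving a term linear in the degree.
    have hterm : ∀ k ∈ Finset.range (n / m + 1),
        mixedRise α r p (Function.update l (n + 1) (k + 1)) (n + 1) * stepProb α t l n (k + 1)
          = mixedRise α r p l n / ((n : ℝ) - α * (n / m + 1 : ℕ))
            * ((deg l (k + 1) n : ℝ) - α + p k) := fun k hk => by
      have h1 := natCast_sub_pos hα (hdeg k hk)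
      rw [mixedRise_succ_of_not_arrival hα hp (k := k)
        (by rw [deg_congr (hup _)]; exact hdeg k hk) (Function.update_self ..),
        mixedRise_congr (hup _), deg_congr (hup _), stepProb_of_not_dvd ht hd, degreeBiased,
        hK, if_pos ⟨by omega, Nat.succ_le_of_lt (Finset.mem_range.1 hk)⟩]
      field_simp
    -- Label 0 has probability zero; the other labels are shifted to k + 1, and those beyond the
    -- newest vertex drop out.
    rw [tsum_eq_zero_add' ENNReal.summable, tsum_eq_sum (s := Finset.range (n / m + 1))]
    · rw [stepProb_of_not_dvd ht hd, degreeBiased, if_neg (by omega), ENNReal.ofReal_zero,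
        mul_zero, zero_add]
      simp_rw [← ENNReal.ofReal_mul (mixedRise_pos hα).le]
      rw [← ENNReal.ofReal_sum_of_nonneg, Finset.sum_congr rfl hterm, ← Finset.mul_sum,
        Finset.sum_add_distrib, Finset.sum_sub_distrib, ← Nat.cast_sum, h.sum_deg, stepGrowth,
        if_neg hd]
      · congr 1
        simp only [Finset.sum_const, Finset.card_range, nsmul_eq_mul]
        ring
      · intro i hi
        exact Nat.lt_succ_iff.2 (Nat.div_le_div_right hi.le)
      · intro k hk
        rw [hterm k hk]
        have h1 := natCast_sub_pos hα (hdeg k hk)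
        have h2 := mixedRise_pos (r := r) (p := p) (l := l) (n := n) hα
        positivity
    · intro k hk
      rw [Finset.mem_range] at hk
      rw [stepProb_of_not_dvd ht hd, degreeBiased, hK, if_neg (by omega)]
      simp

end Step

/-! ### The normalizing constants -/

/-- The mean of `mixedRise` after `n` edge ends. -/
noncomputable def meanRise (α : ℝ) (m : ℕ) (p : ℕ → ℕ) (n : ℕ) : ℝ :=
  ∏ i ∈ Finset.range n, stepGrowth α m p i

lemma meanRise_pos {α : ℝ} (hα : α < 1) {m : ℕ} (hm : 2 ≤ m) (p : ℕ → ℕ) (n : ℕ) :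
    0 < meanRise α m p n := Finset.prod_pos fun _ _ => stepGrowth_pos hα hm

/-- Each block of 2d edge ends is one arrival followed by 2d - 1 biased steps, whose ratios make up
`growth`. -/
lemma meanRise_mul {α : ℝ} {d : ℕ} (hd : 1 ≤ d) (p : ℕ → ℕ) (K : ℕ) :
    meanRise α (2 * d) p (2 * d * K) = ∏ k ∈ Finset.range K,
      (rise (1 - α) (p k) * growth α d k (∑ i ∈ Finset.range (k + 1), p i)) := by
  induction K with
  | zero => simp [meanRise]
  | succ K ih =>
    rw [Finset.prod_range_succ, ← ih, meanRise, mul_add, mul_one, Finset.prod_range_add]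
    congr 1
    have h2 : 0 < 2 * d := by omega
    rw [show Finset.range (2 * d) = Finset.range (2 * d - 1 + 1) by congr 1; omega,
      Finset.prod_range_succ', mul_comm]
    congr 1
    · simp [stepGrowth, h2]
    · rw [growth, rise, rise, ← Finset.prod_div_distrib]
      refine Finset.prod_congr rfl fun i hi => ?_
      have hi := Finset.mem_range.1 hi
      have hdiv : (2 * d * K + (i + 1)) / (2 * d) = K := by
        rw [Nat.mul_add_div h2, Nat.div_eq_of_lt (by omega), add_zero]
      have hnd : ¬ 2 * d ∣ 2 * d * K + (i + 1) := fun h => by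
        have := Nat.le_of_dvd (by omega) ((Nat.dvd_add_right (dvd_mul_right _ _)).1 h)
        omega
      rw [stepGrowth, if_neg hnd, hdiv]
      push_cast
      congr 1 <;> ring


/-! ### The law of the label process -/

/-- The first `n` labels. -/
def initialPath {Ω : Type*} (L : ℕ → Ω → ℕ) (n : ℕ) (ω : Ω) : Finset.Icc 1 n → ℕ := fun i => L i ω

/-- The label sequence continuing `x` by zeros. -/
def extendPath {n : ℕ} (x : Finset.Icc 1 n → ℕ) (i : ℕ) : ℕ :=
  if h : i ∈ Finset.Icc 1 n then x ⟨i, h⟩ else 0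

lemma extendPath_initialPath {Ω : Type*} (L : ℕ → Ω → ℕ) (n : ℕ) (ω : Ω) :
    ∀ i ∈ Finset.Icc 1 n, L i ω = extendPath (initialPath L n ω) i := fun i hi => by
  rw [extendPath, dif_pos hi, initialPath]

lemma initialPath_eq_iff {Ω : Type*} {L : ℕ → Ω → ℕ} {n : ℕ} {ω : Ω} {x : Finset.Icc 1 n → ℕ} :
    initialPath L n ω = x ↔ ∀ i ∈ Finset.Icc 1 n, L i ω = extendPath x i := by
  constructor
  · rintro rfl; exact extendPath_initialPath L n ω
  · intro h
    funext i
    rw [initialPath, h i i.2, extendPath, dif_pos i.2]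

section LabelLaw

variable {Ω : Type*} [mΩ : MeasurableSpace Ω] {μ : Measure Ω} [IsProbabilityMeasure μ] {α : ℝ}
  {t : ℕ → ℕ∞} {L : ℕ → Ω → ℕ}

lemma measurable_initialPath (hL : ∀ n, Measurable (L n)) (n : ℕ) :
    Measurable (initialPath L n) :=
  measurable_pi_lambda _ fun i => hL i

/-- The filtration generated by the labels. -/
def labelFiltration (hL : ∀ n, Measurable (L n)) : Filtration ℕ mΩ where
  seq n := MeasurableSpace.comap (initialPath L n) inferInstance
  mono' := by
    intro a b hab
    have h : initialPath L a = (fun (x : Finset.Icc 1 b → ℕ) (i : Finset.Icc 1 a) =>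
        x ⟨i, Finset.Icc_subset_Icc_right hab i.2⟩) ∘ initialPath L b := rfl
    simp only
    rw [h, ← MeasurableSpace.comap_comp]
    exact MeasurableSpace.comap_mono (Measurable.comap_le (by fun_prop))
  le' n := (measurable_initialPath hL n).comap_le

lemma IsAlphaTGraph.measure_cylinder (hL : IsAlphaTGraph μ α t L) (n : ℕ)
    (x : Finset.Icc 1 n → ℕ) (k : ℕ) :
    μ {ω | initialPath L n ω = x ∧ L (n + 1) ω = k}
      = μ {ω | initialPath L n ω = x} * ENNReal.ofReal (stepProb α t (extendPath x) n k) := by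
  have h := hL.law n (Function.update (extendPath x) (n + 1) k)
  have hup : ∀ i ∈ Finset.Icc 1 n, Function.update (extendPath x) (n + 1) k i = extendPath x i :=
    fun i hi => by
      rw [Function.update_of_ne]
      have := (Finset.mem_Icc.1 hi).2
      omega
  have e1 : {ω | ∀ i ∈ Finset.Icc 1 (n + 1), L i ω = Function.update (extendPath x) (n + 1) k i}
      = {ω | initialPath L n ω = x ∧ L (n + 1) ω = k} := by
    ext ω
    simp only [Set.mem_ofPred_eq, initialPath_eq_iff]
    rw [← Finset.insert_Icc_right_eq_Icc_add_one (by omega), Finset.forall_mem_insert,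
      Function.update_self, and_comm]
    refine and_congr_left fun _ => forall₂_congr fun i hi => ?_
    rw [hup i hi]
  have e2 : {ω | ∀ i ∈ Finset.Icc 1 n, L i ω = Function.update (extendPath x) (n + 1) k i}
      = {ω | initialPath L n ω = x} := by
    ext ω
    simp only [Set.mem_ofPred_eq, initialPath_eq_iff]
    refine forall₂_congr fun i hi => ?_
    rw [hup i hi]
  rw [e1, e2, Function.update_self, stepProb_congr α t hup] at h
  rw [← ofReal_measureReal, h, ENNReal.ofReal_mul measureReal_nonneg, ofReal_measureReal]

/-- Integrating out the label number `n + 1`. -/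
lemma IsAlphaTGraph.lintegral_succ (hL : IsAlphaTGraph μ α t L) (n : ℕ)
    {F : (ℕ → ℕ) → ℕ → ENNReal}
    (hF : ∀ l l' : ℕ → ℕ, (∀ i ∈ Finset.Icc 1 n, l i = l' i) → F l = F l') :
    ∫⁻ ω, F (fun i => L i ω) (L (n + 1) ω) ∂μ
      = ∫⁻ ω, ∑' k, F (fun i => L i ω) k
        * ENNReal.ofReal (stepProb α t (fun i => L i ω) n k) ∂μ := by
  have hX := measurable_initialPath hL.measurable n
  have hXL : Measurable fun ω => (initialPath L n ω, L (n + 1) ω) := hX.prodMk (hL.measurable _)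
  have h1 : ∀ ω, F (fun i => L i ω) = F (extendPath (initialPath L n ω)) := fun ω =>
    hF _ _ (extendPath_initialPath L n ω)
  have h2 : ∀ ω k, stepProb α t (fun i => L i ω) n k
      = stepProb α t (extendPath (initialPath L n ω)) n k := fun ω k =>
    stepProb_congr α t (extendPath_initialPath L n ω) k
  simp_rw [h1, h2]
  rw [← lintegral_map (f := fun y : (Finset.Icc 1 n → ℕ) × ℕ => F (extendPath y.1) y.2)
      (measurable_of_countable _) hXL,
    ← lintegral_map (f := fun x : Finset.Icc 1 n → ℕ => ∑' k, F (extendPath x) k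
      * ENNReal.ofReal (stepProb α t (extendPath x) n k)) (measurable_of_countable _) hX,
    lintegral_countable', lintegral_countable', ENNReal.tsum_prod']
  refine tsum_congr fun x => ?_
  rw [← ENNReal.tsum_mul_right]
  refine tsum_congr fun k => ?_
  rw [Measure.map_apply hXL (measurableSet_singleton _),
    Measure.map_apply hX (measurableSet_singleton _), mul_right_comm, mul_assoc]
  congr 1
  have := hL.measure_cylinder n x k
  convert this using 2
  · ext ω
    simp [Prod.ext_iff]
  · rfl

/-- Integrating out the next label against the indicator that its probability vanishes gives 0. -/
lemma IsAlphaTGraph.ae_stepProb_ne_zero (hL : IsAlphaTGraph μ α t L) :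
    ∀ᵐ ω ∂μ, ∀ n, stepProb α t (fun i => L i ω) n (L (n + 1) ω) ≠ 0 := by
  rw [ae_all_iff]
  intro n
  have h := hL.lintegral_succ n (F := fun l k => if stepProb α t l n k = 0 then 1 else 0)
    fun l l' hl => by funext k; simp only [stepProb_congr α t hl]
  have h0 : ∀ ω k, ((if stepProb α t (fun i => L i ω) n k = 0 then 1 else 0 : ENNReal)
      * ENNReal.ofReal (stepProb α t (fun i => L i ω) n k)) = 0 := fun ω k => by
    split_ifs with h
    · rw [h]; simp
    · simp
  simp_rw [h0] at h
  simp only [tsum_zero, lintegral_zero] at h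
  have hX := measurable_initialPath hL.measurable n
  have hXL : Measurable fun ω => (initialPath L n ω, L (n + 1) ω) := hX.prodMk (hL.measurable _)
  have hm : Measurable fun ω => (if stepProb α t (fun i => L i ω) n (L (n + 1) ω) = 0
      then 1 else 0 : ENNReal) := by
    have : (fun ω => (if stepProb α t (fun i => L i ω) n (L (n + 1) ω) = 0
      then 1 else 0 : ENNReal)) = (fun y : (Finset.Icc 1 n → ℕ) × ℕ =>
        (if stepProb α t (extendPath y.1) n y.2 = 0 then 1 else 0 : ENNReal)) ∘
          fun ω => (initialPath L n ω, L (n + 1) ω) := by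
      funext ω
      simp only [Function.comp, stepProb_congr α t (extendPath_initialPath L n ω)]
    rw [this]
    exact (measurable_of_countable _).comp hXL
  rw [lintegral_eq_zero_iff hm] at h
  filter_upwards [h] with ω hω h'
  simp [h'] at hω

variable {m r : ℕ} {p : ℕ → ℕ}

lemma IsAlphaTGraph.ae_admissible (hL : IsAlphaTGraph μ α t L) (hm : 0 < m)
    (ht : ∀ j, 1 ≤ j → t j = ((m * (j - 1) + 1 : ℕ) : ℕ∞)) :
    ∀ᵐ ω ∂μ, ∀ n, Admissible m (fun i => L i ω) n :=
  hL.ae_stepProb_ne_zero.mono fun _ hω n => admissible_of_stepProb_ne_zero hm ht hω n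

/-! ### The martingale of mixed rising factorials -/

lemma stronglyMeasurable_mixedRise (hL : ∀ n, Measurable (L n)) (n : ℕ) :
    StronglyMeasurable[labelFiltration hL n] fun ω => mixedRise α r p (fun i => L i ω) n := by
  have h : (fun ω => mixedRise α r p (fun i => L i ω) n)
      = (fun x : Finset.Icc 1 n → ℕ => mixedRise α r p (extendPath x) n) ∘ initialPath L n := by
    funext ω
    exact mixedRise_congr (extendPath_initialPath L n ω)
  rw [h]
  exact ((measurable_of_countable _).comp (comap_measurable _)).stronglyMeasurable

lemma measurable_mixedRise (hL : ∀ n, Measurable (L n)) (n : ℕ) :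
    Measurable fun ω => mixedRise α r p (fun i => L i ω) n :=
  ((stronglyMeasurable_mixedRise hL n).mono ((labelFiltration hL).le n)).measurable

/-- The martingale property before normalization. It is phrased with lower integrals because
integrability is deduced from it afterwards. -/
lemma IsAlphaTGraph.setLIntegral_mixedRise_succ (hL : IsAlphaTGraph μ α t L) (hα : α < 1)
    (hm : 2 ≤ m) (ht : ∀ j, 1 ≤ j → t j = ((m * (j - 1) + 1 : ℕ) : ℕ∞))
    (hp : ∀ j, r ≤ j → p j = 0) (n : ℕ) {s : Set Ω}
    (hs : MeasurableSet[labelFiltration hL.measurable n] s) :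
    ∫⁻ ω in s, ENNReal.ofReal (mixedRise α r p (fun i => L i ω) (n + 1)) ∂μ
      = ENNReal.ofReal (stepGrowth α m p n)
        * ∫⁻ ω in s, ENNReal.ofReal (mixedRise α r p (fun i => L i ω) n) ∂μ := by
  classical
  have hs' := (labelFiltration hL.measurable).le n s hs
  obtain ⟨B, -, rfl⟩ := hs
  set F : (ℕ → ℕ) → ℕ → ENNReal := fun l k =>
    if (fun i : Finset.Icc 1 n => l i) ∈ B then
      ENNReal.ofReal (mixedRise α r p (Function.update l (n + 1) k) (n + 1)) else 0 with hF
  have hFc : ∀ l l' : ℕ → ℕ, (∀ i ∈ Finset.Icc 1 n, l i = l' i) → F l = F l' := fun l l' h => by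
    funext k
    have h1 : (fun i : Finset.Icc 1 n => l i) = fun i : Finset.Icc 1 n => l' i :=
      funext fun i => h i i.2
    have h2 : mixedRise α r p (Function.update l (n + 1) k) (n + 1)
        = mixedRise α r p (Function.update l' (n + 1) k) (n + 1) := by
      refine mixedRise_congr fun i hi => ?_
      by_cases hi' : i = n + 1
      · subst hi'; simp
      · rw [Function.update_of_ne hi', Function.update_of_ne hi']
        have := Finset.mem_Icc.1 hi
        exact h i (Finset.mem_Icc.2 ⟨this.1, by omega⟩)
    simp only [hF, h1, h2]
  have key := hL.lintegral_succ n hFc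
  rw [← lintegral_indicator hs', ← lintegral_indicator hs',
    ← lintegral_const_mul' _ _ ENNReal.ofReal_ne_top]
  have e1 : ∀ ω, F (fun i => L i ω) (L (n + 1) ω) = (initialPath L n ⁻¹' B).indicator
      (fun ω => ENNReal.ofReal (mixedRise α r p (fun i => L i ω) (n + 1))) ω := fun ω => by
    have : Function.update (fun i => L i ω) (n + 1) (L (n + 1) ω) = fun i => L i ω :=
      Function.update_eq_self (n + 1) fun i => L i ω
    simp only [hF, this, Set.indicator_apply, Set.mem_preimage]
    rfl
  simp_rw [e1] at key
  rw [key]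
  refine lintegral_congr_ae ?_
  filter_upwards [hL.ae_admissible (by omega : 0 < m) ht] with ω hω
  by_cases hB : initialPath L n ω ∈ B
  · have hB' : (fun i : Finset.Icc 1 n => L i ω) ∈ B := hB
    simp only [hF, if_pos hB']
    rw [tsum_mixedRise_mul_stepProb hα hm ht hp (hω n), Set.indicator_of_mem (by exact hB),
      ENNReal.ofReal_mul (stepGrowth_pos hα hm).le]
  · have hB' : ¬ (fun i : Finset.Icc 1 n => L i ω) ∈ B := hB
    simp only [hF, if_neg hB']
    rw [Set.indicator_of_notMem (by exact hB)]
    simp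

lemma IsAlphaTGraph.lintegral_mixedRise (hL : IsAlphaTGraph μ α t L) (hα : α < 1)
    (hm : 2 ≤ m) (ht : ∀ j, 1 ≤ j → t j = ((m * (j - 1) + 1 : ℕ) : ℕ∞))
    (hp : ∀ j, r ≤ j → p j = 0) (n : ℕ) :
    ∫⁻ ω, ENNReal.ofReal (mixedRise α r p (fun i => L i ω) n) ∂μ
      = ENNReal.ofReal (meanRise α m p n) := by
  induction n with
  | zero => simp [meanRise]
  | succ n ih =>
    have := hL.setLIntegral_mixedRise_succ hα hm ht hp n MeasurableSet.univ
    rw [Measure.restrict_univ, ih, ← ENNReal.ofReal_mul (stepGrowth_pos hα hm).le] at this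
    rw [this, meanRise, meanRise, Finset.prod_range_succ, mul_comm]

lemma IsAlphaTGraph.integrable_mixedRise (hL : IsAlphaTGraph μ α t L) (hα : α < 1)
    (hm : 2 ≤ m) (ht : ∀ j, 1 ≤ j → t j = ((m * (j - 1) + 1 : ℕ) : ℕ∞))
    (hp : ∀ j, r ≤ j → p j = 0) (n : ℕ) :
    Integrable (fun ω => mixedRise α r p (fun i => L i ω) n) μ := by
  refine ⟨(measurable_mixedRise hL.measurable n).aestronglyMeasurable, ?_⟩
  rw [hasFiniteIntegral_iff_ofReal (ae_of_all _ fun _ => (mixedRise_pos hα).le),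
    hL.lintegral_mixedRise hα hm ht hp]
  exact ENNReal.ofReal_lt_top

lemma IsAlphaTGraph.integral_mixedRise (hL : IsAlphaTGraph μ α t L) (hα : α < 1)
    (hm : 2 ≤ m) (ht : ∀ j, 1 ≤ j → t j = ((m * (j - 1) + 1 : ℕ) : ℕ∞))
    (hp : ∀ j, r ≤ j → p j = 0) (n : ℕ) :
    ∫ ω, mixedRise α r p (fun i => L i ω) n ∂μ = meanRise α m p n := by
  rw [integral_eq_lintegral_of_nonneg_ae (ae_of_all _ fun _ => (mixedRise_pos hα).le)
    (measurable_mixedRise hL.measurable n).aestronglyMeasurable,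
    hL.lintegral_mixedRise hα hm ht hp, ENNReal.toReal_ofReal (meanRise_pos hα hm _ _).le]

lemma IsAlphaTGraph.martingale_mixedRise (hL : IsAlphaTGraph μ α t L) (hα : α < 1)
    (hm : 2 ≤ m) (ht : ∀ j, 1 ≤ j → t j = ((m * (j - 1) + 1 : ℕ) : ℕ∞))
    (hp : ∀ j, r ≤ j → p j = 0) :
    Martingale (fun n ω => mixedRise α r p (fun i => L i ω) n / meanRise α m p n)
      (labelFiltration hL.measurable) μ := by
  refine martingale_of_setIntegral_eq_succ
    (fun n => by
      simp only [div_eq_mul_inv]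
      exact (stronglyMeasurable_mixedRise hL.measurable n).mul_const _)
    (fun n => (hL.integrable_mixedRise hα hm ht hp n).div_const _) fun n s hs => ?_
  rw [integral_div, integral_div,
    integral_eq_lintegral_of_nonneg_ae (ae_of_all _ fun _ => (mixedRise_pos hα).le)
      (measurable_mixedRise hL.measurable n).aestronglyMeasurable,
    integral_eq_lintegral_of_nonneg_ae (ae_of_all _ fun _ => (mixedRise_pos hα).le)
      (measurable_mixedRise hL.measurable (n + 1)).aestronglyMeasurable,
    hL.setLIntegral_mixedRise_succ hα hm ht hp n hs, ENNReal.toReal_mul,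
    ENNReal.toReal_ofReal (stepGrowth_pos hα hm).le, meanRise, meanRise, Finset.prod_range_succ,
    mul_comm (stepGrowth _ _ _ _), mul_div_mul_right _ _ (stepGrowth_pos hα hm).ne']

/-- Doob's convergence theorem: the martingale is positive with mean one, hence bounded in L¹. -/
lemma IsAlphaTGraph.ae_tendsto_mixedRise (hL : IsAlphaTGraph μ α t L) (hα : α < 1)
    (hm : 2 ≤ m) (ht : ∀ j, 1 ≤ j → t j = ((m * (j - 1) + 1 : ℕ) : ℕ∞))
    (hp : ∀ j, r ≤ j → p j = 0) :
    ∃ X : Ω → ℝ, Measurable X ∧ ∀ᵐ ω ∂μ, Tendsto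
      (fun n => mixedRise α r p (fun i => L i ω) n / meanRise α m p n) atTop (𝓝 (X ω)) := by
  have hM := hL.martingale_mixedRise hα hm ht hp
  refine ⟨_, Filtration.stronglyMeasurable_limit_process'.measurable,
    hM.submartingale.ae_tendsto_limitProcess (R := 1) fun n => ?_⟩
  have hpos : ∀ ω, 0 ≤ mixedRise α r p (fun i => L i ω) n / meanRise α m p n := fun ω =>
    div_nonneg (mixedRise_pos hα).le (meanRise_pos hα hm _ _).le
  rw [eLpNorm_one_eq_lintegral_enorm]
  simp_rw [Real.enorm_of_nonneg (hpos _)]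
  rw [← ofReal_integral_eq_lintegral_ofReal (hM.integrable n) (ae_of_all _ hpos), integral_div,
    hL.integral_mixedRise hα hm ht hp, div_self (meanRise_pos hα hm _ _).ne']
  simp

end LabelLaw

/-! ### Limits -/

/-- Quotient of two instances of Euler's limit for Γ. -/
lemma tendsto_rpow_mul_prod {a x : ℝ} (ha : 0 < a) (hx : 0 ≤ x) :
    Tendsto (fun K : ℕ => (K : ℝ) ^ (-x) * ∏ k ∈ Finset.range K, ((a + x + k) / (a + k))) atTop
      (𝓝 (Real.Gamma a / Real.Gamma (a + x))) := by
  have hax : 0 < a + x := by positivity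
  have h1 := (Real.GammaSeq_tendsto_Gamma a).div (Real.GammaSeq_tendsto_Gamma (a + x))
    (Real.Gamma_pos_of_pos hax).ne'
  -- `Real.GammaSeq` has K + 1 factors in its denominator; this removes the last one.
  have h2 : Tendsto (fun K : ℕ => (a + K) / (a + x + K)) atTop (𝓝 1) := by
    have h3 : Tendsto (fun K : ℕ => 1 - x / (a + x + K)) atTop (𝓝 (1 - 0)) :=
      tendsto_const_nhds.sub (tendsto_const_nhds.div_atTop
        (tendsto_atTop_add_const_left _ _ tendsto_natCast_atTop_atTop))
    rw [sub_zero] at h3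
    refine h3.congr fun K => ?_
    have : 0 < a + x + K := by positivity
    field_simp
    ring
  have h4 := h1.mul h2
  rw [mul_one] at h4
  refine h4.congr' ?_
  filter_upwards [eventually_gt_atTop 0] with K hK
  have hK0 : (0 : ℝ) < K := by exact_mod_cast hK
  have p1 : 0 < ∏ k ∈ Finset.range K, (a + k) := Finset.prod_pos fun k _ => by positivity
  have p2 : 0 < ∏ k ∈ Finset.range K, (a + x + k) := Finset.prod_pos fun k _ => by positivity
  simp only [Pi.div_apply, Real.GammaSeq]
  rw [Finset.prod_range_succ, Finset.prod_range_succ, Finset.prod_div_distrib,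
    Real.rpow_add hK0, Real.rpow_neg hK0.le]
  have q1 : 0 < a + K := by positivity
  have q2 : 0 < a + x + K := by positivity
  have q3 := Real.rpow_pos_of_pos hK0 a
  have q4 := Real.rpow_pos_of_pos hK0 x
  have q5 : (0 : ℝ) < K.factorial := by positivity
  field_simp

/-- Squeeze n between the multiples m⌊n/m⌋ and m(⌊n/m⌋ + 1); replacing K by K + 1 in the power costs
a factor tending to 1. -/
lemma tendsto_of_monotone_of_tendsto_mul {f : ℕ → ℝ} (hf : Monotone f) (hf0 : 0 ≤ f 0) {m : ℕ}
    (hm : 0 < m) {γ c : ℝ} (hγ : 0 ≤ γ)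
    (h : Tendsto (fun K : ℕ => (K : ℝ) ^ (-γ) * f (m * K)) atTop (𝓝 c)) :
    Tendsto (fun n : ℕ => ((n : ℝ) / m) ^ (-γ) * f n) atTop (𝓝 c) := by
  have hq : Tendsto (fun n : ℕ => n / m) atTop atTop := Nat.tendsto_div_const_atTop hm.ne'
  have hr : Tendsto (fun K : ℕ => ((K : ℝ) + 1) / K) atTop (𝓝 1) := by
    have h3 : Tendsto (fun K : ℕ => 1 + 1 / (K : ℝ)) atTop (𝓝 (1 + 0)) :=
      tendsto_const_nhds.add (tendsto_const_nhds.div_atTop tendsto_natCast_atTop_atTop)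
    rw [add_zero] at h3
    refine h3.congr' ?_
    filter_upwards [eventually_gt_atTop 0] with K hK
    have hK0 : (K : ℝ) ≠ 0 := by exact_mod_cast hK.ne'
    field_simp
  have hrp : ∀ s : ℝ, Tendsto (fun K : ℕ => (((K : ℝ) + 1) / K) ^ s) atTop (𝓝 1) := fun s => by
    have := (Real.continuousAt_rpow_const 1 s (Or.inl one_ne_zero)).tendsto.comp hr
    rwa [Real.one_rpow] at this
  have hlow : Tendsto (fun K : ℕ => ((K : ℝ) + 1) ^ (-γ) * f (m * K)) atTop (𝓝 c) := by
    have := (hrp (-γ)).mul h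
    rw [one_mul] at this
    refine this.congr' ?_
    filter_upwards [eventually_gt_atTop 0] with K hK
    have hK0 : (0 : ℝ) < K := by exact_mod_cast hK
    rw [← mul_assoc, ← Real.mul_rpow (by positivity) hK0.le, div_mul_cancel₀ _ hK0.ne']
  have hup : Tendsto (fun K : ℕ => (K : ℝ) ^ (-γ) * f (m * (K + 1))) atTop (𝓝 c) := by
    have := (hrp γ).mul ((tendsto_add_atTop_iff_nat 1).2 h)
    rw [one_mul] at this
    refine this.congr' ?_
    filter_upwards [eventually_gt_atTop 0] with K hK
    have hK0 : (0 : ℝ) < K := by exact_mod_cast hK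
    push_cast
    rw [← mul_assoc, Real.div_rpow (by positivity) hK0.le, Real.rpow_neg (by positivity),
      Real.rpow_neg hK0.le]
    have q3 := Real.rpow_pos_of_pos hK0 γ
    have q4 := Real.rpow_pos_of_pos (show 0 < (K : ℝ) + 1 by positivity) γ
    field_simp
  have hm0 : (0 : ℝ) < m := by exact_mod_cast hm
  refine tendsto_of_tendsto_of_tendsto_of_le_of_le' (hlow.comp hq) (hup.comp hq) ?_ ?_
  · filter_upwards [eventually_ge_atTop m] with n hn
    have h0 : 0 < n / m := Nat.div_pos hn hm
    have hn0 : (0 : ℝ) < n := by exact_mod_cast hm.trans_le hn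
    have hlt : (n : ℝ) / m ≤ (n / m : ℕ) + 1 := (Nat.lt_floor_add_one _).le.trans_eq (by
      rw [Nat.floor_div_natCast, Nat.floor_natCast])
    simp only [Function.comp]
    refine mul_le_mul (Real.rpow_le_rpow_of_nonpos (by positivity) hlt (by linarith))
      (hf (Nat.mul_div_le n m)) (hf0.trans (hf (Nat.zero_le _))) (by positivity)
  · filter_upwards [eventually_ge_atTop m] with n hn
    have h0 : 0 < n / m := Nat.div_pos hn hm
    have h0' : (0 : ℝ) < (n / m : ℕ) := by exact_mod_cast h0
    simp only [Function.comp]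
    refine mul_le_mul (Real.rpow_le_rpow_of_nonpos h0' Nat.cast_div_le (by linarith))
      (hf ?_) (hf0.trans (hf (Nat.zero_le _))) (by positivity)
    exact (Nat.lt_mul_div_succ n hm).le

/-- Means converge along an almost surely convergent sequence with bounded second moments. -/
lemma integral_eq_of_tendsto_of_sq_le {Ω : Type*} [MeasurableSpace Ω] {μ : Measure Ω}
    [IsProbabilityMeasure μ] {Y : ℕ → Ω → ℝ} {Z : Ω → ℝ} {c B : ℝ}
    (hY0 : ∀ n ω, 0 ≤ Y n ω) (hYi : ∀ n, Integrable (Y n) μ)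
    (hY2 : ∀ n, Integrable (fun ω => Y n ω ^ 2) μ) (hB : ∀ n, ∫ ω, Y n ω ^ 2 ∂μ ≤ B)
    (hZ : ∀ᵐ ω ∂μ, Tendsto (fun n => Y n ω) atTop (𝓝 (Z ω)))
    (hc : Tendsto (fun n => ∫ ω, Y n ω ∂μ) atTop (𝓝 c)) : ∫ ω, Z ω ∂μ = c := by
  have hZm : AEStronglyMeasurable Z μ :=
    aestronglyMeasurable_of_tendsto_ae atTop (fun n => (hYi n).aestronglyMeasurable) hZ
  have hZ0 : ∀ᵐ ω ∂μ, 0 ≤ Z ω := hZ.mono fun ω h => ge_of_tendsto' h fun n => hY0 n ω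
  have hB0 : 0 ≤ B := (integral_nonneg fun ω => sq_nonneg _).trans (hB 0)
  -- Fatou's lemma carries the second-moment bound to the limit.
  have hZ2 : Integrable (fun ω => Z ω ^ 2) μ ∧ ∫ ω, Z ω ^ 2 ∂μ ≤ B := by
    have hle : ∫⁻ ω, ENNReal.ofReal (Z ω ^ 2) ∂μ ≤ ENNReal.ofReal B := by
      calc ∫⁻ ω, ENNReal.ofReal (Z ω ^ 2) ∂μ
          = ∫⁻ ω, liminf (fun n => ENNReal.ofReal (Y n ω ^ 2)) atTop ∂μ := by
            refine lintegral_congr_ae (hZ.mono fun ω h => ?_)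
            exact ((ENNReal.continuous_ofReal.tendsto _).comp (h.pow 2)).liminf_eq.symm
        _ ≤ liminf (fun n => ∫⁻ ω, ENNReal.ofReal (Y n ω ^ 2) ∂μ) atTop :=
            lintegral_liminf_le' fun n => (hY2 n).aestronglyMeasurable.aemeasurable.ennreal_ofReal
        _ ≤ ENNReal.ofReal B := by
            refine liminf_le_of_le (by isBoundedDefault) fun b hb => ?_
            obtain ⟨n, hn⟩ := hb.exists
            refine hn.trans ?_
            rw [← ofReal_integral_eq_lintegral_ofReal (hY2 n) (ae_of_all _ fun _ => sq_nonneg _)]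
            exact ENNReal.ofReal_le_ofReal (hB n)
    have hi : Integrable (fun ω => Z ω ^ 2) μ := by
      refine ⟨hZm.pow 2, ?_⟩
      rw [hasFiniteIntegral_iff_ofReal (ae_of_all _ fun _ => sq_nonneg _)]
      exact hle.trans_lt ENNReal.ofReal_lt_top
    refine ⟨hi, ?_⟩
    rwa [← ofReal_integral_eq_lintegral_ofReal hi (ae_of_all _ fun _ => sq_nonneg _),
      ENNReal.ofReal_le_ofReal_iff hB0] at hle
  have hZi : Integrable Z μ := by
    refine ((integrable_const 1).add hZ2.1).mono' hZm (ae_of_all _ fun ω => ?_)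
    rw [Real.norm_eq_abs, Pi.add_apply, ← sq_abs (Z ω)]
    nlinarith [sq_nonneg (|Z ω| - 1), abs_nonneg (Z ω)]
  -- Truncation at R costs at most B/R uniformly in n, because W - min(W, R) ≤ W²/R; truncated means
  -- converge by dominated convergence.
  have htrunc : ∀ (W : Ω → ℝ), (∀ᵐ ω ∂μ, 0 ≤ W ω) → Integrable W μ →
      Integrable (fun ω => W ω ^ 2) μ → ∫ ω, W ω ^ 2 ∂μ ≤ B → ∀ R : ℝ, 0 < R →
      |∫ ω, W ω ∂μ - ∫ ω, min (W ω) R ∂μ| ≤ B / R := by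
    intro W hW0 hWi hW2 hWB R hR
    have hmin : Integrable (fun ω => min (W ω) R) μ := hWi.inf (integrable_const R)
    rw [← integral_sub hWi hmin, abs_of_nonneg
      (integral_nonneg fun ω => sub_nonneg.2 (min_le_left _ _))]
    refine (integral_mono_ae (hWi.sub hmin) (hW2.div_const R) ?_).trans ?_
    · filter_upwards [hW0] with ω hω
      simp only [Pi.sub_apply]
      rw [le_div_iff₀ hR]
      rcases le_total (W ω) R with h | h
      · rw [min_eq_left h, sub_self, zero_mul]; positivity
      · rw [min_eq_right h]; nlinarith
    · rw [integral_div]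
      gcongr
  have hlim : ∀ R : ℝ, 0 < R →
      Tendsto (fun n => ∫ ω, min (Y n ω) R ∂μ) atTop (𝓝 (∫ ω, min (Z ω) R ∂μ)) := by
    intro R hR
    refine tendsto_integral_of_dominated_convergence (fun _ => R)
      (fun n => ((hYi n).inf (integrable_const R)).aestronglyMeasurable) (integrable_const R)
      (fun n => ae_of_all _ fun ω => ?_) (hZ.mono fun ω h => h.min tendsto_const_nhds)
    rw [Real.norm_of_nonneg (le_min (hY0 n ω) hR.le)]
    exact min_le_right _ _
  have hfin : ∀ R : ℝ, 0 < R → |∫ ω, Z ω ∂μ - c| ≤ B / R + B / R := by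
    intro R hR
    have h1 := htrunc Z hZ0 hZi hZ2.1 hZ2.2 R hR
    have h2 : |c - ∫ ω, min (Z ω) R ∂μ| ≤ B / R :=
      le_of_tendsto' ((hc.sub (hlim R hR)).abs) fun n =>
        htrunc (Y n) (ae_of_all _ (hY0 n)) (hYi n) (hY2 n) (hB n) R hR
    rw [abs_le] at h1 h2 ⊢
    constructor <;> linarith [h1.1, h1.2, h2.1, h2.2]
  have hz : Tendsto (fun R : ℝ => B / R + B / R) atTop (𝓝 (0 + 0)) :=
    (tendsto_const_nhds.div_atTop tendsto_id).add (tendsto_const_nhds.div_atTop tendsto_id)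
  rw [add_zero] at hz
  have : |∫ ω, Z ω ∂μ - c| ≤ 0 :=
    ge_of_tendsto hz ((eventually_gt_atTop 0).mono fun R hR => hfin R hR)
  exact sub_eq_zero.1 (abs_nonpos_iff.1 this)

/-! ### Asymptotics of the normalizing constants -/

section Model

variable {α : ℝ} {d : ℕ}

/-- The growth exponent of the degrees. -/
noncomputable def exponent (α : ℝ) (d : ℕ) : ℝ := (2 * d - 1) / (2 * d - α)

lemma exponent_pos (hα : α < 1) (hd : 1 ≤ d) : 0 < exponent α d :=
  div_pos (two_mul_sub_one_pos hd) (two_mul_sub_pos hα hd)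

lemma integral_pow_lawZ'_eq (hα : α < 1) (hd : 1 ≤ d) (n : ℕ) :
    ∫ x, x ^ n ∂lawZ' α d = ∏ i ∈ Finset.range (2 * d - 1),
      Real.Gamma (1 - ((i : ℝ) + 1) / (2 * d - α) + n / (2 * d - α))
        / Real.Gamma (1 - ((i : ℝ) + 1) / (2 * d - α)) :=
  integral_pow_gammaPowLaw hα hd le_rfl n

lemma integral_pow_lawZ'_pos (hα : α < 1) (hd : 1 ≤ d) (n : ℕ) : 0 < ∫ x, x ^ n ∂lawZ' α d := by
  have hA := two_mul_sub_pos hα hd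
  rw [integral_pow_lawZ'_eq hα hd]
  refine Finset.prod_pos fun i hi => ?_
  have hi := div_lt_one_of_lt_two_mul hα hd (Finset.mem_range.1 hi)
  have h1 : 0 < 1 - ((i : ℝ) + 1) / (2 * d - α) := by linarith
  exact div_pos (Real.Gamma_pos_of_pos (by positivity)) (Real.Gamma_pos_of_pos h1)

/-- Each of the 2d - 1 factors of `growth_eq_prod` contributes the power q/A, which together give q
times `exponent α d`. -/
lemma tendsto_rpow_mul_prod_growth (hα : α < 1) (hd : 1 ≤ d) (q : ℕ) :
    Tendsto (fun K : ℕ => ((K : ℝ) ^ (-exponent α d)) ^ q * ∏ k ∈ Finset.range K, growth α d k q)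
      atTop (𝓝 (∫ x, x ^ q ∂lawZ' α d)⁻¹) := by
  have hA := two_mul_sub_pos hα hd
  have h := tendsto_finsetProd (Finset.range (2 * d - 1)) fun i hi =>
    tendsto_rpow_mul_prod (a := 1 - ((i : ℝ) + 1) / (2 * d - α)) (x := (q : ℝ) / (2 * d - α))
      (sub_pos.2 (div_lt_one_of_lt_two_mul hα hd (Finset.mem_range.1 hi))) (by positivity)
  rw [integral_pow_lawZ'_eq hα hd, ← Finset.prod_inv_distrib]
  simp_rw [inv_div]
  refine h.congr fun K => ?_
  rw [Finset.prod_mul_distrib, Finset.prod_const, Finset.card_range, Finset.prod_comm]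
  congr 1
  · rw [← Real.rpow_natCast, ← Real.rpow_natCast, ← Real.rpow_mul (Nat.cast_nonneg _),
      ← Real.rpow_mul (Nat.cast_nonneg _), exponent, Nat.cast_sub (by omega)]
    congr 1
    push_cast
    ring
  · exact Finset.prod_congr rfl fun k _ => (growth_eq_prod hα hd k q).symm

/-- From index r on, the partial sum of exponents is the full sum and the arrival factor is 1;
`limitMoment` corrects the first r factors. -/
lemma tendsto_rpow_mul_meanRise (hα : α < 1) (hd : 1 ≤ d) {r : ℕ} {p : ℕ → ℕ}
    (hp : ∀ j, r ≤ j → p j = 0) :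
    Tendsto (fun K : ℕ => ((K : ℝ) ^ (-exponent α d)) ^ (∑ i ∈ Finset.range r, p i)
        * meanRise α (2 * d) p (2 * d * K)) atTop
      (𝓝 (limitMoment α d r p * (∫ x, x ^ (∑ i ∈ Finset.range r, p i) ∂lawZ' α d)⁻¹)) := by
  refine ((tendsto_rpow_mul_prod_growth hα hd _).const_mul (limitMoment α d r p)).congr' ?_
  filter_upwards [eventually_ge_atTop r] with K hK
  rw [mul_left_comm, meanRise_mul hd]
  congr 1
  obtain ⟨s, rfl⟩ := Nat.exists_eq_add_of_le hK
  rw [Finset.prod_range_add, Finset.prod_range_add, limitMoment, ← mul_assoc,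
    ← Finset.prod_mul_distrib]
  congr 1
  · refine Finset.prod_congr rfl fun k _ => ?_
    rw [div_mul_cancel₀ _ (growth_pos hα hd _ _).ne']
  · refine Finset.prod_congr rfl fun k _ => ?_
    rw [hp (r + k) (by omega), rise_zero, one_mul, add_assoc r, Finset.sum_range_add]
    congr 1
    rw [Finset.sum_eq_zero (s := Finset.range (k + 1)) fun i _ => hp _ (by omega), add_zero]

end Model

/-! ### The limiting degrees and their mixed moments -/

section LabelLaw

variable {Ω : Type*} [MeasurableSpace Ω] {μ : Measure Ω} [IsProbabilityMeasure μ] {α : ℝ} {d : ℕ}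
  {t : ℕ → ℕ∞} {L : ℕ → Ω → ℕ}

lemma mixedRise_single (α : ℝ) (j : ℕ) (l : ℕ → ℕ) (n : ℕ) :
    mixedRise α (j + 1) (Pi.single j 1) l n = degRise α 1 (deg l (j + 1) n) := by
  rw [mixedRise, Finset.prod_range_succ, Pi.single_eq_same,
    Finset.prod_eq_one, one_mul]
  intro i hi
  rw [Pi.single_eq_of_ne (Finset.mem_range.1 hi).ne, degRise_zero_left]

lemma tendsto_natCast_rpow_neg_exponent (hα : α < 1) (hd : 1 ≤ d) :
    Tendsto (fun K : ℕ => (K : ℝ) ^ (-exponent α d)) atTop (𝓝 0) :=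
  (tendsto_rpow_neg_atTop (exponent_pos hα hd)).comp tendsto_natCast_atTop_atTop

/-- The rescaled degree of a vertex converges almost surely along the times `2dK`. -/
lemma IsAlphaTGraph.exists_tendsto_deg_mul (hL : IsAlphaTGraph μ α t L) (hα : α < 1) (hd : 1 ≤ d)
    (ht : ∀ j, 1 ≤ j → t j = ((2 * d * (j - 1) + 1 : ℕ) : ℕ∞)) (j : ℕ) :
    ∃ X : Ω → ℝ, Measurable X ∧ ∀ᵐ ω ∂μ, Tendsto (fun K : ℕ => (K : ℝ) ^ (-exponent α d)
      * (deg (fun i => L i ω) (j + 1) (2 * d * K) : ℝ)) atTop (𝓝 (X ω)) := by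
  have hp : ∀ i, j + 1 ≤ i → (Pi.single j 1 : ℕ → ℕ) i = 0 := fun i hi =>
    Pi.single_eq_of_ne (by omega) _
  obtain ⟨X, hXm, hX⟩ := hL.ae_tendsto_mixedRise hα (by omega : 2 ≤ 2 * d) ht hp
  have hc := tendsto_rpow_mul_meanRise hα hd hp
  have hs : ∑ i ∈ Finset.range (j + 1), (Pi.single j 1 : ℕ → ℕ) i = 1 := by
    rw [Finset.sum_range_succ, Pi.single_eq_same, Finset.sum_eq_zero fun i hi =>
      Pi.single_eq_of_ne (Finset.mem_range.1 hi).ne _]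
  rw [hs] at hc
  simp only [pow_one] at hc
  set c := limitMoment α d (j + 1) (Pi.single j 1) * (∫ x, x ∂lawZ' α d)⁻¹
  refine ⟨fun ω => c * X ω, hXm.const_mul c, ?_⟩
  filter_upwards [hX, hL.ae_admissible (by omega : 0 < 2 * d) ht] with ω hω hadm
  have hmul : Tendsto (fun K : ℕ => 2 * d * K) atTop atTop :=
    tendsto_id.const_mul_atTop' (by omega)
  -- With the single exponent 1, `mixedRise` is deg - α; the shift α vanishes after rescaling.
  have h1 := (hc.mul (hω.comp hmul)).add
    ((tendsto_natCast_rpow_neg_exponent hα hd).mul_const α)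
  rw [zero_mul, add_zero] at h1
  refine h1.congr' ?_
  filter_upwards [eventually_gt_atTop j] with K hK
  have h0 : deg (fun i => L i ω) (j + 1) (2 * d * K) ≠ 0 :=
    ((hadm _).deg_pos (by omega) (Nat.mul_lt_mul_of_pos_left hK (by omega))).ne'
  have h2 := (meanRise_pos hα (by omega : 2 ≤ 2 * d) (Pi.single j 1) (2 * d * K)).ne'
  simp only [Function.comp]
  rw [mixedRise_single, degRise, if_neg h0, rise_one]
  field_simp
  ring

/-- The mixed moments of the limits of the rescaled degrees. -/
lemma IsAlphaTGraph.integral_prod_pow (hL : IsAlphaTGraph μ α t L) (hα : α < 1) (hd : 1 ≤ d)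
    (ht : ∀ j, 1 ≤ j → t j = ((2 * d * (j - 1) + 1 : ℕ) : ℕ∞)) {X : ℕ → Ω → ℝ}
    (hX : ∀ᵐ ω ∂μ, ∀ j, Tendsto (fun K : ℕ => (K : ℝ) ^ (-exponent α d)
      * (deg (fun i => L i ω) (j + 1) (2 * d * K) : ℝ)) atTop (𝓝 (X j ω)))
    {r : ℕ} {p : ℕ → ℕ} (hp : ∀ j, r ≤ j → p j = 0) :
    ∫ ω, ∏ j ∈ Finset.range r, X j ω ^ p j ∂μ
      = limitMoment α d r p * (∫ x, x ^ (∑ i ∈ Finset.range r, p i) ∂lawZ' α d)⁻¹ := by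
  have hm : 2 ≤ 2 * d := by omega
  have hp2 : ∀ j, r ≤ j → 2 * p j = 0 := fun j hj => by rw [hp j hj]
  set P := ∑ i ∈ Finset.range r, p i with hP
  have hP2 : ∑ i ∈ Finset.range r, 2 * p i = 2 * P := by rw [hP, Finset.mul_sum]
  have hlim2 := tendsto_rpow_mul_meanRise hα hd hp2
  rw [hP2] at hlim2
  -- The means with doubled exponents converge after rescaling, hence are bounded; they dominate the
  -- second moments.
  obtain ⟨B, hB⟩ := hlim2.bddAbove_range
  set s : ℕ → ℝ := fun K => (K : ℝ) ^ (-exponent α d) with hs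
  have hs0 : ∀ K, 0 ≤ s K := fun K => Real.rpow_nonneg (Nat.cast_nonneg _) _
  have hsq : ∀ K ω, (s K ^ P * mixedRise α r p (fun i => L i ω) (2 * d * K)) ^ 2
      ≤ s K ^ (2 * P) * mixedRise α r (fun j => 2 * p j) (fun i => L i ω) (2 * d * K) :=
    fun K ω => by
      rw [mul_pow, ← pow_mul, mul_comm P]
      exact mul_le_mul_of_nonneg_left (mixedRise_sq_le hα) (pow_nonneg (hs0 K) _)
  have hi2 : ∀ K, Integrable (fun ω => s K ^ (2 * P)
      * mixedRise α r (fun j => 2 * p j) (fun i => L i ω) (2 * d * K)) μ := fun K =>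
    (hL.integrable_mixedRise hα hm ht hp2 _).const_mul _
  have hi1 : ∀ K, Integrable (fun ω => (s K ^ P
      * mixedRise α r p (fun i => L i ω) (2 * d * K)) ^ 2) μ := fun K => by
    refine (hi2 K).mono' ?_ (ae_of_all _ fun ω => ?_)
    · exact (((measurable_mixedRise hL.measurable _).const_mul _).pow_const 2).aestronglyMeasurable
    · rw [Real.norm_of_nonneg (sq_nonneg _)]; exact hsq K ω
  refine integral_eq_of_tendsto_of_sq_le (B := B)
    (Y := fun K ω => s K ^ P * mixedRise α r p (fun i => L i ω) (2 * d * K))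
    (fun K ω => mul_nonneg (pow_nonneg (hs0 K) _) (mixedRise_pos hα).le)
    (fun K => (hL.integrable_mixedRise hα hm ht hp _).const_mul _) hi1 (fun K => ?_) ?_ ?_
  · refine (integral_mono (hi1 K) (hi2 K) (hsq K)).trans ?_
    rw [integral_const_mul, hL.integral_mixedRise hα hm ht hp2]
    exact hB ⟨K, rfl⟩
  · filter_upwards [hX, hL.ae_admissible (by omega : 0 < 2 * d) ht] with ω hω hadm
    -- One power of the scale goes to each factor deg - α + i, so the shifts i - α disappear and
    -- each rising factorial becomes a power of X_j.
    have h1 : ∀ j ∈ Finset.range r, Tendsto (fun K : ℕ =>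
        ∏ i ∈ Finset.range (p j), (s K * deg (fun i => L i ω) (j + 1) (2 * d * K)
          + s K * (i - α))) atTop (𝓝 (∏ i ∈ Finset.range (p j), X j ω)) := fun j _ => by
      refine tendsto_finsetProd _ fun i _ => ?_
      have := (hω j).add ((tendsto_natCast_rpow_neg_exponent hα hd).mul_const ((i : ℝ) - α))
      rwa [zero_mul, add_zero] at this
    have h2 := tendsto_finsetProd (Finset.range r) h1
    simp only [Finset.prod_const, Finset.card_range] at h2
    refine h2.congr' ?_
    filter_upwards [eventually_ge_atTop r] with K hK
    rw [mixedRise, hP, ← Finset.prod_pow_eq_pow_sum, ← Finset.prod_mul_distrib]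
    refine Finset.prod_congr rfl fun j hj => ?_
    have hj := Finset.mem_range.1 hj
    have h0 : deg (fun i => L i ω) (j + 1) (2 * d * K) ≠ 0 :=
      ((hadm _).deg_pos (by omega) (Nat.mul_lt_mul_of_pos_left (by omega) (by omega))).ne'
    rw [degRise, if_neg h0, rise, ← Finset.card_range (p j), ← Finset.prod_const,
      Finset.card_range, ← Finset.prod_mul_distrib]
    refine Finset.prod_congr rfl fun i _ => ?_
    ring
  · simp_rw [integral_const_mul, hL.integral_mixedRise hα hm ht hp]
    exact tendsto_rpow_mul_meanRise hα hd hp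

end LabelLaw
end PrefAttach

/-! ### Assembling the limit and the identities -/

theorem proposition11 {Ω : Type*} [MeasurableSpace Ω] (μ : Measure Ω) [IsProbabilityMeasure μ]
    (α : ℝ) (hα : α < 1) (d : ℕ) (hd : 1 ≤ d)
    (t : ℕ → ℕ∞) (ht : ∀ j, 1 ≤ j → t j = ((2 * d * (j - 1) + 1 : ℕ) : ℕ∞))
    (L : ℕ → Ω → ℕ) (hL : PrefAttach.IsAlphaTGraph μ α t L) :
    ∃ ξ : ℕ → Ω → ℝ, (∀ j, Measurable (ξ j)) ∧ ∀ r : ℕ, 1 ≤ r →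
      (∀ᵐ ω ∂μ, Tendsto
        (fun n : ℕ => (((n : ℝ) / (2 * d)) ^ (-((2 * d - 1) / (2 * d - α)) : ℝ)) •
          (fun j : Fin r => (PrefAttach.deg (fun i => L i ω) ((j : ℕ) + 1) n : ℝ)))
        atTop (𝓝 fun j : Fin r => ξ ((j : ℕ) + 1) ω)) ∧
      PrefAttach.scaledLaw (PrefAttach.lawZ α d r) (μ.map fun ω (j : Fin r) => ξ ((j : ℕ) + 1) ω)
        = PrefAttach.scaledLaw (gammaMeasure (r * (2 * d - α)) 1) (PrefAttach.stickLaw α d r) ∧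
      PrefAttach.scaledLaw (PrefAttach.lawZ' α d) (μ.map fun ω (j : Fin r) => ξ ((j : ℕ) + 1) ω)
        = PrefAttach.scaledLaw
            (Measure.mconv (gammaMeasure (r * (2 * d - α)) 1) (PrefAttach.betaProdLaw α d r))
            (PrefAttach.stickLaw α d r) ∧
      PrefAttach.scaledLaw (PrefAttach.lawZ' α d) (μ.map fun ω (j : Fin r) => ξ ((j : ℕ) + 1) ω)
        = PrefAttach.scaledLaw
            (Measure.mconv (gammaMeasure (r * (2 * d - α) - 2 * d + 1) 1)
              (PrefAttach.betaProdLaw α d (r - 1)))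
            (PrefAttach.stickLaw α d r) ∧
      PrefAttach.scaledLaw (PrefAttach.lawZ'' α d r)
          (μ.map fun ω (j : Fin r) => ξ ((j : ℕ) + 1) ω)
        = PrefAttach.scaledLaw (gammaMeasure (1 - α) 1) (PrefAttach.stickLaw α d r) := by
  have hm : 0 < 2 * d := by omega
  choose X hXm hX using fun j => hL.exists_tendsto_deg_mul hα hd ht j
  have hX' := ae_all_iff.2 hX
  -- Vertices are numbered from 1 and X from 0; the value at index 0 is never used.
  refine ⟨fun j => X (j - 1), fun j => hXm _, fun r hr => ⟨?_, ?_⟩⟩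
  · filter_upwards [hX'] with ω hω
    refine tendsto_pi_nhds.2 fun j => ?_
    have hmono : Monotone fun n => (PrefAttach.deg (fun i => L i ω) ((j : ℕ) + 1) n : ℝ) :=
      fun a b hab => Nat.cast_le.2 (PrefAttach.deg_mono _ _ hab)
    have := PrefAttach.tendsto_of_monotone_of_tendsto_mul hmono (Nat.cast_nonneg _) hm
      (PrefAttach.exponent_pos hα hd).le (hω j)
    simpa [PrefAttach.exponent] using this
  · have hXr : Measurable fun ω (j : Fin r) => X ((j : ℕ) + 1 - 1) ω :=
      measurable_pi_lambda _ fun j => hXm _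
    have := Measure.isProbabilityMeasure_map (μ := μ) hXr.aemeasurable
    refine PrefAttach.scaledLaw_identities hα hd hr ?_ fun p hp => ?_
    · have hms : MeasurableSet {x : Fin r → ℝ | ∀ j, 0 ≤ x j} := by
        rw [Set.ofPred_forall]
        exact MeasurableSet.iInter fun j =>
          measurableSet_le measurable_const (measurable_pi_apply j)
      rw [ae_map_iff hXr.aemeasurable hms]
      filter_upwards [hX'] with ω hω j
      exact ge_of_tendsto' (hω j) fun K => by positivity
    · rw [integral_map hXr.aemeasurable (Continuous.aestronglyMeasurable (by fun_prop))]
      have h := hL.integral_prod_pow hα hd ht hX' hp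
      simp_rw [Finset.prod_range] at h
      simp only [Nat.add_sub_cancel]
      rw [h, mul_left_comm,
        mul_inv_cancel₀ (PrefAttach.integral_pow_lawZ'_pos hα hd _).ne', mul_one]
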